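/- A rearrangement invariant (r.i.) space is a nonzero Banach space $E$ of (classes modulo a.e. equality of) real measurable functions on $[0,1]$ with Lebesgue measure $\mathrm{mes}$ such that (i) if $|x|\le|y|$ a.e. and $y\in E$, then $x\in E$ and $\|x\|_E\le\|y\|_E$; (ii) if $y\in E$ and $\mathrm{mes}\{|x|>\tau\}=\mathrm{mes}\{|y|>\tau\}$ for all $\tau>0$, then $x\in E$ and $\|x\|_E=\|y\|_E$; (iii) either $E$ is separable, or $E$ coincides, with equality of norms, with its second Köthe dual $E''$, where $\|x\|_{E'}=\sup\{\int_0^1|x(t)y(t)|\,dt:\ \|y\|_E\le1\}$ and $E'=\{x:\|x\|_{E'}<\infty\}$. For a measurable function $f$ on $[0,1]$ let $\pi(f)=\sum_{i=1}^N f_i$, where $f_1,f_2,\dots$ are independent copies of $f$ and $N$ is a Poisson random variable with parameter $1$ independent of $(f_i)$. A random variable is said to belong to $E$ if $E$ contains a function on $[0,1]$ with the same distribution. An r.i. space $E$ has the Kruglov property, $E\in\mathbb K$, if for every measurable $f$ on $[0,1]$: $f\in E\iff\pi(f)\in E$. Let $\exp L_1$ be the Orlicz space with norm $\|x\|=\inf\{\lambda>0:\int_0^1(e^{|x(t)|/\lambda}-1)\,dt\le1\}$,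 and let $(\exp L_1)_0$ be the closure of $L_\infty$ in $\exp L_1$, with the same norm. Then: 1. For every r.i. space $E\in\mathbb K$ there is an r.i. space $F\in\mathbb K$ with $F\subsetneq E$. 2. Hence the family of r.i. spaces with the Kruglov property, ordered by inclusion, has no minimal element. 3. In particular, $(\exp L_1)_0$ is an r.i. space with the Kruglov property which is not minimal: there is an r.i. space $F\in\mathbb K$ with $F\subsetneq(\exp L_1)_0$. -/

import Mathlib

open MeasureTheory ProbabilityTheory Filter Topology
open scoped ENNReal NNReal unitInterval

noncomputable section

namespace RI

/-- Classes (modulo equality almost everywhere) of real measurable functions on `[0,1]` with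
Lebesgue measure. -/
abbrev Fn : Type := I →ₘ[(volume : Measure I)] ℝ

/-- `|x|` and `|y|` have the same distribution function. -/
def Equimeasurable (x y : Fn) : Prop :=
  ∀ τ : ℝ, 0 < τ → volume {t : I | τ < |x t|} = volume {t : I | τ < |y t|}

/-! A normed space `E` of functions on `[0,1]` is encoded by its extended norm `N`, where
`N x = ‖x‖_E` for `x ∈ E` and `N x = ∞` for `x ∉ E`. -/

/-- The set of functions of finite extended norm, that is, the space with extended norm `N`. -/
def finiteSet (N : Fn → ℝ≥0∞) : Set Fn := {x | N x < ∞}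

/-- The norm of the Köthe dual: `‖x‖_{E'} = sup {∫ |x y| : ‖y‖_E ≤ 1}`, infinite off `E'`. -/
def kotheDualNorm (N : Fn → ℝ≥0∞) (x : Fn) : ℝ≥0∞ :=
  ⨆ (y : Fn) (_ : N y ≤ 1), ∫⁻ t : I, ‖x t * y t‖ₑ

/-- The space with extended norm `N` is separable. -/
def IsSeparableNorm (N : Fn → ℝ≥0∞) : Prop :=
  ∃ D : Set Fn, D.Countable ∧ D ⊆ finiteSet N ∧
    ∀ x ∈ finiteSet N, ∀ ε : ℝ≥0∞, 0 < ε → ∃ y ∈ D, N (x - y) < ε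

/-- The space with extended norm `N` is complete. -/
def IsCompleteNorm (N : Fn → ℝ≥0∞) : Prop :=
  ∀ u : ℕ → Fn, (∀ n, u n ∈ finiteSet N) →
    (∀ ε : ℝ≥0∞, 0 < ε → ∃ n₀ : ℕ, ∀ m ≥ n₀, ∀ n ≥ n₀, N (u m - u n) < ε) →
    ∃ x ∈ finiteSet N, Tendsto (fun n => N (u n - x)) atTop (𝓝 0)

end RI

/-- A rearrangement invariant (r.i.) space on `[0,1]`: a nonzero Banach space `E` of (classes of)
measurable functions, given by its extended norm (`‖x‖_E` on `E`, and `∞` off `E`), which is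
either separable or equal, with the same norm, to its second Köthe dual. -/
structure RISpace where
  /-- The norm of `E`, extended by `∞` to functions that are not in `E`. -/
  enorm : RI.Fn → ℝ≥0∞
  enorm_add_le : ∀ x y, enorm (x + y) ≤ enorm x + enorm y
  enorm_smul : ∀ (c : ℝ) x, enorm (c • x) = ‖c‖ₑ * enorm x
  eq_zero_of_enorm : ∀ x, enorm x = 0 → x = 0
  complete : RI.IsCompleteNorm enorm
  nontrivial : ∃ x, x ≠ 0 ∧ enorm x < ∞
  ideal : ∀ x y : RI.Fn, (∀ᵐ t : I, |x t| ≤ |y t|) → enorm x ≤ enorm y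
  symmetric : ∀ x y : RI.Fn, RI.Equimeasurable x y → enorm x = enorm y
  separable_or_maximal : RI.IsSeparableNorm enorm ∨
    ∀ x, enorm x = RI.kotheDualNorm (RI.kotheDualNorm enorm) x

namespace RISpace

/-- The set of functions that belong to the r.i. space. -/
def carrier (E : RISpace) : Set RI.Fn := RI.finiteSet E.enorm

end RISpace

namespace RI

/-- The probability measure on `ℕ × [0,1]^ℕ` under which the first coordinate `N` is Poisson with
parameter `1`, the coordinates `ω 0, ω 1, …` are uniform on `[0,1]`, and all are independent. -/
def poissonProb : Measure (ℕ × (ℕ → I)) :=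
  (poissonMeasure 1).prod (Measure.infinitePi fun _ : ℕ => (volume : Measure I))

/-- The random variable `π(f) = f₁ + … + f_N`, where `f₁, f₂, …` are independent copies of `f`,
and `N` is Poisson with parameter `1` and independent of them. -/
def poissonSum (f : Fn) (p : ℕ × (ℕ → I)) : ℝ := ∑ i ∈ Finset.range p.1, f (p.2 i)

end RI

namespace RISpace

/-- A random variable `X` on a probability space `(Ω, P)` belongs to the r.i. space `E` if `E`
contains a function on `[0,1]` with the same distribution. -/
def HasRandomVariable (E : RISpace) {Ω : Type*} [MeasurableSpace Ω] (P : Measure Ω)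
    (X : Ω → ℝ) : Prop :=
  ∃ g ∈ E.carrier, IdentDistrib (g : I → ℝ) X volume P

/-- The Kruglov property: `f ∈ E` if and only if `π(f) ∈ E`. -/
def HasKruglov (E : RISpace) : Prop :=
  ∀ f : RI.Fn, f ∈ E.carrier ↔ E.HasRandomVariable RI.poissonProb (RI.poissonSum f)

end RISpace

namespace RI

/-- `S` is the set of elements of an r.i. space with the Kruglov property. -/
def IsKruglovSet (S : Set Fn) : Prop := ∃ E : RISpace, E.HasKruglov ∧ E.carrier = S

/-- The norm `inf {c > 0 : ∫ M (|x| / c) ≤ 1}` of the Orlicz space `L_M`, infinite off `L_M`. -/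
def orliczNorm (M : ℝ → ℝ) (x : Fn) : ℝ≥0∞ :=
  ⨅ (c : ℝ) (_ : 0 < c) (_ : ∫⁻ t : I, ENNReal.ofReal (M (|x t| / c)) ≤ 1), ENNReal.ofReal c

/-- The norm of the Orlicz space `exp L₁`, with `M u = exp u - 1`. -/
def expL1Norm : Fn → ℝ≥0∞ := orliczNorm fun u => Real.exp u - 1

open Classical in
/-- The norm of the separable part `E₀` (the closure of `L_∞` in the space `E` with extended norm
`N`), infinite off `E₀`. -/
def separablePartNorm (N : Fn → ℝ≥0∞) (x : Fn) : ℝ≥0∞ :=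
  if ∀ ε : ℝ≥0∞, 0 < ε → ∃ y ∈ Lp ℝ ∞ (volume : Measure I), N (x - y) < ε then N x else ∞

end RI

end

/-!
Write `π(f)` for the Poisson sum of independent copies of `f`. On the probability space of these
sums `π` is linear in `f`; pulled back to `[0,1]` by a measure preserving map it becomes a positive
linear operator, `kruglov`. As `π(f)` is a copy of `f` on the event that there is one summand, and
dilations are bounded in r.i. spaces, `π(f) ∈ E` always implies `f ∈ E`
(`IsRINorm.le_three_mul_kruglov`). So `E` has the Kruglov property iff `kruglov` maps `E` into `E`,
and a gliding hump argument shows that it is then bounded (`kruglovBounded_of_forall_lt_top`).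

Let `E` have the Kruglov property. The number `π(1)` of summands is an unbounded element of `E`, so
that the norms of indicator functions vanish with the measure of the set
(`IsRINorm.supportContinuous`). Moreover `π(1)` is in the closure of `L_∞`
(`IsRINorm.tailsVanish_kruglov_one`): the probability of at least `n` summands is at most `1 / n!`,
so the tails of `π(1)` are much lighter than those of `2 π(χ_A)` for any set `A` of positive
measure, and the latter function has small norm if `A` has small measure. Therefore there are
levels `0 = n₀ < n₁ < …` such that the tail `(n_j π(1) - n_{j+1})⁺` has norm at most `2^{-(j+1)}`.

The functions `x` with `‖(|x| - n_j)⁺‖_E ≤ 2^{-j}` for all `j` form the unit ball of an r.i. norm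
(`IsRINorm.isUnitBall_tailBall`). The operator `kruglov` is bounded in this norm because
`|π(x)| ≤ π((|x| - n_j)⁺) + n_j π(1)`, which controls the tail of `π(x)` at the level `n_{j+1}` by
that of `x` at the level `n_j`. On the other hand, if the norm were bounded by a multiple of that of
`E`, an indicator function normalized in `E` and supported on a set of very small measure would
violate the bound on its tail at a fixed level. The smaller space is the closure of `L_∞` in the new
norm, which is separable (`IsRINorm.isSeparableNorm_separablePartNorm`) and is preserved by
`kruglov` (`IsRINorm.tailsVanish_kruglov`).

For `exp L₁`, the identity `∫ exp π(g) = exp (∫ exp g - 1)` for `g ≥ 0` shows that `kruglov`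
preserves the finiteness of exponential moments, so it is bounded on `exp L₁` and preserves the
closure of `L_∞`.
-/

noncomputable section

namespace RI

/-! ### Rearrangements -/

/-- The decreasing rearrangement of `|x|`, with values in `[0, ∞]`. -/
def rearrangement (x : Fn) (t : I) : ℝ≥0∞ :=
  ⨆ (q : ℝ≥0) (_ : ENNReal.ofReal t < volume {s : I | (q : ℝ) < |x s|}), (q : ℝ≥0∞)

theorem measurableSet_lt_abs (x : Fn) (τ : ℝ) : MeasurableSet {s : I | τ < |x s|} :=
  measurableSet_lt measurable_const x.measurable.abs

theorem volume_ofReal_lt {d : ℝ≥0∞} (hd : d ≤ 1) :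
    volume {t : I | ENNReal.ofReal t < d} = d := by
  lift d to ℝ≥0 using ne_top_of_le_ne_top ENNReal.one_ne_top hd
  have h : {t : I | ENNReal.ofReal t < d} =
      Set.Iio (⟨d, d.2, by exact_mod_cast hd⟩ : I) := by
    ext t
    rw [Set.mem_ofPred_eq, ENNReal.ofReal_lt_coe_iff t.2.1]
    rfl
  rw [h, unitInterval.volume_Iio]
  simp

/-- The nontrivial implication holds because the distribution function of `|x|` is continuous from
the right. -/
theorem lt_rearrangement_iff (x : Fn) (τ : ℝ≥0) (t : I) :
    (τ : ℝ≥0∞) < rearrangement x t ↔ ENNReal.ofReal t < volume {s : I | (τ : ℝ) < |x s|} := by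
  constructor
  · intro h
    obtain ⟨q, h⟩ := lt_iSup_iff.1 h
    obtain ⟨hq, h⟩ := lt_iSup_iff.1 h
    refine hq.trans_le (measure_mono fun s hs => ?_)
    have : (τ : ℝ) < q := by exact_mod_cast h
    exact this.trans hs
  · intro h
    have hU : {s : I | (τ : ℝ) < |x s|} = ⋃ n : ℕ, {s : I | (τ : ℝ) + 1 / (n + 1) < |x s|} := by
      ext s
      simp only [Set.mem_ofPred_eq, Set.mem_iUnion]
      constructor
      · intro hs
        obtain ⟨n, hn⟩ := exists_nat_one_div_lt (sub_pos.2 hs)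
        exact ⟨n, by linarith⟩
      · rintro ⟨n, hn⟩
        have : (0 : ℝ) < 1 / (n + 1) := by positivity
        linarith
    have hmono : Monotone fun n : ℕ => {s : I | (τ : ℝ) + 1 / (n + 1) < |x s|} := by
      intro m n hmn s hs
      have : (1 : ℝ) / (n + 1) ≤ 1 / (m + 1) := by gcongr
      simp only [Set.mem_ofPred_eq] at hs ⊢
      linarith
    rw [hU, hmono.measure_iUnion] at h
    obtain ⟨n, hn⟩ := lt_iSup_iff.1 h
    have hτ : τ < τ + 1 / (n + 1) := lt_add_of_pos_right _ (by positivity)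
    refine (ENNReal.coe_lt_coe.2 hτ).trans_le ?_
    exact le_iSup₂_of_le (τ + 1 / (n + 1)) (by push_cast; exact hn) le_rfl

theorem volume_lt_rearrangement (x : Fn) (τ : ℝ≥0) :
    volume {t : I | (τ : ℝ≥0∞) < rearrangement x t} = volume {s : I | (τ : ℝ) < |x s|} := by
  simp_rw [lt_rearrangement_iff]
  exact volume_ofReal_lt prob_le_one

theorem antitone_rearrangement (x : Fn) : Antitone (rearrangement x) := by
  intro s t hst
  refine iSup_mono fun q => iSup_mono' fun h => ⟨lt_of_le_of_lt ?_ h, le_rfl⟩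
  exact ENNReal.ofReal_le_ofReal hst

theorem tendsto_volume_lt_abs (x : Fn) :
    Tendsto (fun n : ℕ => volume {s : I | (n : ℝ) < |x s|}) atTop (𝓝 0) := by
  have h := tendsto_measure_iInter_atTop (μ := (volume : Measure I))
    (s := fun n : ℕ => {s : I | (n : ℝ) < |x s|})
    (fun n => (measurableSet_lt_abs x n).nullMeasurableSet)
    (fun m n hmn s (hs : (n : ℝ) < |x s|) =>
      (lt_of_le_of_lt (by exact_mod_cast hmn) hs : (m : ℝ) < |x s|)) ⟨0, measure_ne_top _ _⟩
  have h0 : (⋂ n : ℕ, {s : I | (n : ℝ) < |x s|}) = ∅ := by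
    ext s
    simp only [Set.mem_iInter, Set.mem_ofPred_eq, Set.mem_empty_iff_false, iff_false, not_forall,
      not_lt]
    exact exists_nat_ge _
  rwa [h0, measure_empty] at h

theorem ae_rearrangement_lt_top (x : Fn) : ∀ᵐ t : I, rearrangement x t < ∞ := by
  have : volume {t : I | ¬ rearrangement x t < ∞} ≤ 0 := by
    refine ge_of_tendsto' (tendsto_volume_lt_abs x) fun n => ?_
    have := volume_lt_rearrangement x n
    rw [NNReal.coe_natCast] at this
    rw [← this]
    refine measure_mono fun t ht => ?_
    have ht : rearrangement x t = ∞ := not_lt_top_iff.1 ht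
    simp [ht]
  exact nonpos_iff_eq_zero.1 this

/-- The decreasing rearrangement of `|x|`, as a class of real functions. The value `∞`, which
`toReal` turns into `0`, is taken at most at the point `0`. -/
def rearr (x : Fn) : Fn :=
  AEEqFun.mk (fun t => (rearrangement x t).toReal)
    (antitone_rearrangement x).measurable.ennreal_toReal.aestronglyMeasurable

theorem coeFn_rearr (x : Fn) : ∀ᵐ t : I, rearr x t = (rearrangement x t).toReal :=
  AEEqFun.coeFn_mk _ _

theorem equimeasurable_rearr (x : Fn) : Equimeasurable x (rearr x) := by
  intro τ hτ
  lift τ to ℝ≥0 using hτ.le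
  rw [← volume_lt_rearrangement]
  refine measure_congr ?_
  filter_upwards [coeFn_rearr x, ae_rearrangement_lt_top x] with t ht hfin
  refine propext ?_
  change (τ : ℝ≥0∞) < rearrangement x t ↔ (τ : ℝ) < |rearr x t|
  rw [ht, abs_of_nonneg ENNReal.toReal_nonneg,
    ← ENNReal.coe_toReal τ, ENNReal.toReal_lt_toReal ENNReal.coe_ne_top hfin.ne]

theorem rearr_le_rearr {x y : Fn}
    (h : ∀ τ : ℝ, 0 < τ → volume {s : I | τ < |x s|} ≤ volume {s : I | τ < |y s|}) :
    ∀ᵐ t : I, |rearr x t| ≤ |rearr y t| := by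
  filter_upwards [coeFn_rearr x, coeFn_rearr y, ae_rearrangement_lt_top y] with t hx hy hfin
  rw [hx, hy, abs_of_nonneg ENNReal.toReal_nonneg, abs_of_nonneg ENNReal.toReal_nonneg]
  refine ENNReal.toReal_mono hfin.ne ?_
  refine iSup_le fun q => iSup_le fun hq => ?_
  rcases eq_or_ne q 0 with rfl | hq0
  · simp
  · exact le_iSup₂_of_le q (hq.trans_le (h q (by positivity))) le_rfl

theorem Equimeasurable.symm {x y : Fn} (h : Equimeasurable x y) : Equimeasurable y x :=
  fun τ hτ => (h τ hτ).symm

/-- Equimeasurability also controls the level `0`, which its definition leaves out. -/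
theorem Equimeasurable.volume_pos_eq {x y : Fn} (h : Equimeasurable x y) :
    volume {t : I | 0 < |x t|} = volume {t : I | 0 < |y t|} := by
  have key : ∀ z : Fn, volume {t : I | 0 < |z t|} =
      ⨆ n : ℕ, volume {t : I | (1 / (n + 1) : ℝ) < |z t|} := by
    intro z
    have hmono : Monotone fun n : ℕ => {t : I | (1 / (n + 1) : ℝ) < |z t|} := by
      intro m n hmn s (hs : (1 / (m + 1) : ℝ) < |z s|)
      have : (1 : ℝ) / (n + 1) ≤ 1 / (m + 1) := by gcongr
      exact this.trans_lt hs
    rw [← hmono.measure_iUnion]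
    congr 1
    ext s
    simp only [Set.mem_ofPred_eq, Set.mem_iUnion]
    exact ⟨fun hs => exists_nat_one_div_lt hs,
      fun ⟨n, hn⟩ => lt_trans (by positivity) hn⟩
  rw [key, key]
  exact iSup_congr fun n => h _ (by positivity)

theorem Equimeasurable.identDistrib {x y : Fn} (h : Equimeasurable x y) :
    IdentDistrib (fun t => |x t|) (fun t => |y t|) volume volume := by
  have hx := x.measurable.abs
  have hy := y.measurable.abs
  refine ⟨hx.aemeasurable, hy.aemeasurable, ?_⟩
  have hpx : IsProbabilityMeasure ((volume : Measure I).map fun t => |x t|) :=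
    Measure.isProbabilityMeasure_map hx.aemeasurable
  have hpy : IsProbabilityMeasure ((volume : Measure I).map fun t => |y t|) :=
    Measure.isProbabilityMeasure_map hy.aemeasurable
  refine Measure.ext_of_Iic _ _ fun τ => ?_
  rw [← Set.compl_Ioi, prob_compl_eq_one_sub measurableSet_Ioi,
    prob_compl_eq_one_sub measurableSet_Ioi, Measure.map_apply hx measurableSet_Ioi,
    Measure.map_apply hy measurableSet_Ioi]
  congr 1
  rcases lt_trichotomy τ 0 with hτ | rfl | hτ
  · have : ∀ z : Fn, (fun t => |z t|) ⁻¹' Set.Ioi τ = Set.univ := fun z =>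
      Set.eq_univ_of_forall fun t => hτ.trans_le (abs_nonneg _)
    rw [this, this]
  · exact h.volume_pos_eq
  · exact h τ hτ

/-! ### Rearrangement invariant norms -/

/-- `N` is an extended norm with the properties that define an r.i. space, except that the space
need be neither separable nor equal to its second Köthe dual. -/
structure IsRINorm (N : Fn → ℝ≥0∞) : Prop where
  add_le : ∀ x y, N (x + y) ≤ N x + N y
  smul : ∀ (c : ℝ) x, N (c • x) = ‖c‖ₑ * N x
  eq_zero : ∀ x, N x = 0 → x = 0
  complete : IsCompleteNorm N
  nontrivial : ∃ x, x ≠ 0 ∧ N x < ∞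
  ideal : ∀ x y : Fn, (∀ᵐ t : I, |x t| ≤ |y t|) → N x ≤ N y
  symmetric : ∀ x y : Fn, Equimeasurable x y → N x = N y

theorem _root_.RISpace.isRINorm (E : RISpace) : IsRINorm E.enorm :=
  ⟨E.enorm_add_le, E.enorm_smul, E.eq_zero_of_enorm, E.complete, E.nontrivial, E.ideal,
    E.symmetric⟩

theorem exists_measurePreserving {Y : Type*} [MeasurableSpace Y] [StandardBorelSpace Y]
    (μ : Measure Y) [IsProbabilityMeasure μ] :
    ∃ θ : I → Y, MeasurePreserving θ volume μ := by
  have := nonempty_of_isProbabilityMeasure μ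
  obtain ⟨θ, hθ, h⟩ := Measure.exists_measurable_map_eq μ
  exact ⟨θ, hθ, h⟩

namespace IsRINorm

variable {N : Fn → ℝ≥0∞}

theorem map_zero (hN : IsRINorm N) : N 0 = 0 := by
  simpa using hN.smul 0 0

theorem sum_le (hN : IsRINorm N) {ι : Type*} (s : Finset ι) (u : ι → Fn) :
    N (∑ i ∈ s, u i) ≤ ∑ i ∈ s, N (u i) :=
  Finset.le_sum_of_subadditive N hN.map_zero.le hN.add_le s u

theorem neg (hN : IsRINorm N) (x : Fn) : N (-x) = N x := by
  simpa using hN.smul (-1) x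

theorem sub_comm (hN : IsRINorm N) (x y : Fn) : N (x - y) = N (y - x) := by
  rw [← hN.neg, neg_sub]

theorem mono_of_volume_le (hN : IsRINorm N) {x y : Fn}
    (h : ∀ τ : ℝ, 0 < τ → volume {s : I | τ < |x s|} ≤ volume {s : I | τ < |y s|}) :
    N x ≤ N y := by
  rw [hN.symmetric _ _ (equimeasurable_rearr x), hN.symmetric _ _ (equimeasurable_rearr y)]
  exact hN.ideal _ _ (rearr_le_rearr h)

/-- Boundedness of dilations. On `[0,1]²` the function `x` is the sum of its restrictions to `M`
horizontal strips of height `1 / M`, and each of these has a smaller distribution function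
than `y`. -/
theorem le_mul_of_volume_le (hN : IsRINorm N) {M : ℕ} (hM : M ≠ 0) {x y : Fn}
    (h : ∀ τ : ℝ, 0 < τ → volume {s : I | τ < |x s|} ≤ M * volume {s : I | τ < |y s|}) :
    N x ≤ M * N y := by
  obtain ⟨θ, hθ⟩ := exists_measurePreserving ((volume : Measure I).prod (volume : Measure I))
  -- The strips are closed: they overlap in null sets, and they cover the endpoint `1`.
  let J : ℕ → Set I := fun i => {u : I | (i : ℝ) ≤ M * u ∧ (M * u : ℝ) ≤ i + 1}
  have hMu : Measurable fun u : I => (M * u : ℝ) := by fun_prop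
  have hJm : ∀ i, MeasurableSet (J i) := fun i =>
    (measurableSet_le measurable_const hMu).inter (measurableSet_le hMu measurable_const)
  have hM0 : (0 : ℝ) < M := by positivity
  have hJv : ∀ i, M * volume (J i) ≤ 1 := by
    intro i
    have : volume (J i) ≤ ENNReal.ofReal (1 / M) := by
      rw [unitInterval.volume_apply]
      calc volume (Subtype.val '' J i) ≤ volume (Set.Icc ((i : ℝ) / M) ((i + 1) / M)) := by
            refine measure_mono ?_
            rintro _ ⟨u, ⟨h1, h2⟩, rfl⟩
            exact ⟨by rw [div_le_iff₀ hM0]; linarith, by rw [le_div_iff₀ hM0]; linarith⟩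
        _ = ENNReal.ofReal (1 / M) := by
            rw [Real.volume_Icc]; congr 1; field_simp; ring
    calc M * volume (J i) ≤ M * ENNReal.ofReal (1 / M) := by gcongr
      _ = 1 := by
        rw [← ENNReal.ofReal_natCast, ← ENNReal.ofReal_mul hM0.le, mul_one_div_cancel hM0.ne']
        simp
  let p : ℕ → I → ℝ := fun i t => (J i).indicator (fun _ => |x (θ t).1|) (θ t).2
  have hpm : ∀ i, Measurable (p i) := by
    intro i
    have hx : Measurable fun q : I × I => (Set.univ ×ˢ J i).indicator (fun q => |x q.1|) q :=
      (x.measurable.abs.comp measurable_fst).indicator (MeasurableSet.univ.prod (hJm i))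
    have : p i = (fun q => (Set.univ ×ˢ J i).indicator (fun q : I × I => |x q.1|) q) ∘ θ := by
      funext t
      by_cases ht : (θ t).2 ∈ J i <;> simp [p, Set.indicator, ht]
    rw [this]
    exact hx.comp hθ.measurable
  let P : ℕ → Fn := fun i => AEEqFun.mk (p i) (hpm i).aestronglyMeasurable
  have hP : ∀ i, ∀ᵐ t : I, P i t = p i t := fun i => AEEqFun.coeFn_mk _ _
  have hp0 : ∀ i t, 0 ≤ p i t := fun i t => Set.indicator_nonneg (fun _ _ => abs_nonneg _) _
  have hθ1 : MeasurePreserving (fun t => (θ t).1) (volume : Measure I) volume :=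
    measurePreserving_fst.comp hθ
  -- A copy of `x` that depends on the first coordinate of the square only.
  let X : Fn := x.compMeasurePreserving _ hθ1
  have hX : ∀ᵐ t : I, X t = x (θ t).1 := AEEqFun.coeFn_compMeasurePreserving x hθ1
  have hxX : N x = N X := by
    refine hN.symmetric _ _ fun τ _ => ?_
    have : volume {t : I | τ < |X t|} = volume {t : I | τ < |x (θ t).1|} := by
      refine measure_congr ?_
      filter_upwards [hX] with t ht
      refine propext ?_
      change τ < |X t| ↔ τ < |x (θ t).1|
      rw [ht]
    rw [this]
    exact (hθ1.measure_preimage (measurableSet_lt_abs x τ).nullMeasurableSet).symm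
  have hPy : ∀ i, N (P i) ≤ N y := by
    intro i
    refine hN.mono_of_volume_le fun τ hτ => ?_
    calc volume {t : I | τ < |P i t|}
        = volume {t : I | θ t ∈ {s : I | τ < |x s|} ×ˢ J i} := by
          refine measure_congr ?_
          filter_upwards [hP i] with t ht
          refine propext ?_
          change τ < |P i t| ↔ (τ < |x (θ t).1| ∧ (θ t).2 ∈ J i)
          rw [ht, abs_of_nonneg (hp0 i t)]
          by_cases h2 : (θ t).2 ∈ J i <;> simp [p, h2, hτ.le]
      _ = volume {s : I | τ < |x s|} * volume (J i) := by
          rw [← Measure.prod_prod]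
          exact hθ.measure_preimage
            ((measurableSet_lt_abs x τ).prod (hJm i)).nullMeasurableSet
      _ ≤ M * volume {s : I | τ < |y s|} * volume (J i) := by gcongr; exact h τ hτ
      _ = volume {s : I | τ < |y s|} * (M * volume (J i)) := by ring
      _ ≤ volume {s : I | τ < |y s|} := mul_le_of_le_one_right' (hJv i)
  calc N x = N X := hxX
    _ ≤ N (∑ i ∈ Finset.range M, P i) := by
      refine hN.ideal _ _ ?_
      have hsum : ∀ᵐ t : I, (∑ i ∈ Finset.range M, P i) t = ∑ i ∈ Finset.range M, P i t := by
        filter_upwards [AEEqFun.coeFn_fun_finsetSum (Finset.range M) P] with t ht using ht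
      filter_upwards [hX, ae_all_iff.2 hP, hsum] with t h1 h2 h3
      rw [h1, h3]
      simp_rw [h2]
      set u : I := (θ t).2 with hu
      obtain ⟨i, hi, hiu⟩ : ∃ i ∈ Finset.range M, u ∈ J i := by
        rcases eq_or_lt_of_le u.2.2 with h1 | h1
        · refine ⟨M - 1, by simp; omega, ?_⟩
          have : ((M - 1 : ℕ) : ℝ) = M - 1 := by
            rw [Nat.cast_sub (by omega)]; simp
          simp [J, this, h1]
        · have h0 : (0 : ℝ) ≤ M * u := mul_nonneg hM0.le u.2.1
          refine ⟨⌊(M * u : ℝ)⌋₊, ?_, Nat.floor_le h0, (Nat.lt_floor_add_one _).le⟩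
          rw [Finset.mem_range, Nat.floor_lt h0]
          nlinarith
      calc |x (θ t).1| = p i t := by simp [p, ← hu, hiu]
        _ ≤ ∑ i ∈ Finset.range M, p i t :=
          Finset.single_le_sum (f := fun i => p i t) (fun i _ => hp0 i t) hi
        _ ≤ _ := le_abs_self _
    _ ≤ ∑ i ∈ Finset.range M, N (P i) := hN.sum_le _ _
    _ ≤ ∑ i ∈ Finset.range M, N y := Finset.sum_le_sum fun i _ => hPy i
    _ = M * N y := by simp

/-- The distribution function of `1` is at most that of a dilation of a multiple of any nonzero
function. -/
theorem one_lt_top (hN : IsRINorm N) : N 1 < ∞ := by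
  obtain ⟨x, hx, hfin⟩ := hN.nontrivial
  obtain ⟨δ, hδ, hpos⟩ : ∃ δ : ℝ, 0 < δ ∧ 0 < volume {s : I | δ < |x s|} := by
    by_contra! hcon
    refine hx (AEEqFun.ext ?_)
    have h : ∀ n : ℕ, ∀ᵐ s : I, |x s| ≤ 1 / (n + 1) := by
      intro n
      have := nonpos_iff_eq_zero.1 (hcon (1 / (n + 1)) (by positivity))
      rw [ae_iff]
      simpa only [not_le] using this
    filter_upwards [ae_all_iff.2 h, AEEqFun.coeFn_zero (α := I) (β := ℝ)] with s hs h0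
    rw [h0]
    by_contra hne
    obtain ⟨n, hn⟩ := exists_nat_one_div_lt (abs_pos.2 hne)
    exact absurd (hs n) (not_le.2 hn)
  obtain ⟨M, hM⟩ := ENNReal.exists_nat_mul_gt hpos.ne' ENNReal.one_ne_top
  have hM0 : M ≠ 0 := by rintro rfl; simp at hM
  refine (hN.le_mul_of_volume_le hM0 (y := δ⁻¹ • x) fun τ _ => ?_).trans_lt ?_
  · rcases lt_or_ge τ 1 with h1 | h1
    · refine prob_le_one.trans (hM.le.trans ?_)
      gcongr (M : ℝ≥0∞) * ?_
      refine measure_mono_ae (μ := (volume : Measure I)) ?_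
      filter_upwards [AEEqFun.coeFn_smul δ⁻¹ x] with s hs
      intro (h2 : δ < |x s|)
      change τ < |(δ⁻¹ • x : Fn) s|
      rw [hs, Pi.smul_apply, smul_eq_mul, abs_mul, abs_of_pos (inv_pos.2 hδ)]
      refine h1.trans_le ?_
      rw [← inv_mul_cancel₀ hδ.ne']
      gcongr
    · have : volume {s : I | τ < |(1 : Fn) s|} = 0 := by
        have : {s : I | τ < |(1 : Fn) s|} = ∅ := by
          ext s
          simpa using h1
        rw [this, measure_empty]
      rw [this]
      exact zero_le
  · rw [hN.smul]
    exact ENNReal.mul_lt_top (ENNReal.natCast_lt_top M) (ENNReal.mul_lt_top (by simp) hfin)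

end IsRINorm

/-! ### Tails and the separable part -/

/-- The tail `(|x| - a)⁺` of `x`. -/
def tail (a : ℝ) (x : Fn) : Fn :=
  AEEqFun.comp (fun r : ℝ => max (|r| - a) 0) (by fun_prop) x

/-- The truncation of `x` to values in `[-a, a]`. -/
def clamp (a : ℝ) (x : Fn) : Fn :=
  AEEqFun.comp (fun r : ℝ => max (-a) (min r a)) (by fun_prop) x

theorem coeFn_tail (a : ℝ) (x : Fn) : ∀ᵐ t : I, tail a x t = max (|x t| - a) 0 :=
  AEEqFun.coeFn_comp _ _ x

theorem coeFn_clamp (a : ℝ) (x : Fn) : ∀ᵐ t : I, clamp a x t = max (-a) (min (x t) a) :=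
  AEEqFun.coeFn_comp _ _ x

theorem abs_clamp_le {a : ℝ} (ha : 0 ≤ a) (x : Fn) : ∀ᵐ t : I, |clamp a x t| ≤ a := by
  filter_upwards [coeFn_clamp a x] with t ht
  rw [ht, abs_le]
  exact ⟨le_max_left _ _, max_le (by linarith) (min_le_right _ _)⟩

theorem abs_sub_clamp {a : ℝ} (ha : 0 ≤ a) (x : Fn) :
    ∀ᵐ t : I, |(x - clamp a x) t| = |tail a x t| := by
  filter_upwards [coeFn_clamp a x, coeFn_tail a x, AEEqFun.coeFn_sub x (clamp a x)] with t h1 h2 h3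
  rw [h3, Pi.sub_apply, h1, h2]
  grind

theorem coeFn_tail_zero (x : Fn) : ∀ᵐ t : I, tail 0 x t = |x t| := by
  filter_upwards [coeFn_tail 0 x] with t ht
  simp [ht]

theorem abs_tail (a : ℝ) (x : Fn) : ∀ᵐ t : I, |tail a x t| = max (|x t| - a) 0 := by
  filter_upwards [coeFn_tail a x] with t ht
  rw [ht, abs_of_nonneg (le_max_right _ _)]

theorem Equimeasurable.tail {x y : Fn} (h : Equimeasurable x y) {a : ℝ} (ha : 0 ≤ a) :
    Equimeasurable (tail a x) (tail a y) := by
  have key : ∀ z : Fn, ∀ τ : ℝ, 0 < τ →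
      volume {t : I | τ < |RI.tail a z t|} = volume {t : I | τ + a < |z t|} := by
    intro z τ hτ
    refine measure_congr ?_
    filter_upwards [coeFn_tail a z] with t ht
    refine propext ?_
    change τ < |RI.tail a z t| ↔ τ + a < |z t|
    rw [ht, abs_of_nonneg (le_max_right _ _), lt_max_iff, lt_sub_iff_add_lt]
    exact or_iff_left hτ.not_gt
  intro τ hτ
  rw [key x τ hτ, key y τ hτ]
  exact h _ (by positivity)

theorem Equimeasurable.smul {x y : Fn} (h : Equimeasurable x y) (c : ℝ) :
    Equimeasurable (c • x) (c • y) := by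
  rcases eq_or_ne c 0 with rfl | hc
  · simp only [zero_smul]
    exact fun _ _ => rfl
  have hc' : 0 < |c| := abs_pos.2 hc
  have key : ∀ z : Fn, ∀ τ : ℝ,
      volume {t : I | τ < |(c • z : Fn) t|} = volume {t : I | τ / |c| < |z t|} := by
    intro z τ
    refine measure_congr ?_
    filter_upwards [AEEqFun.coeFn_smul c z] with t ht
    refine propext ?_
    change τ < |(c • z : Fn) t| ↔ τ / |c| < |z t|
    rw [ht, Pi.smul_apply, smul_eq_mul, abs_mul, div_lt_iff₀' hc']
  intro τ hτ
  rw [key, key]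
  exact h _ (by positivity)

/-- The tails of `x` tend to zero in the norm `N`; for r.i. norms this means that `x` belongs to
the closure of `L_∞`. -/
def TailsVanish (N : Fn → ℝ≥0∞) (x : Fn) : Prop :=
  ∀ ε : ℝ≥0∞, 0 < ε → ∃ n : ℕ, N (tail n x) < ε

/-- The norm of functions bounded by `1` tends to zero with the measure of their support. -/
def SupportContinuous (N : Fn → ℝ≥0∞) : Prop :=
  ∀ ε : ℝ≥0∞, 0 < ε → ∃ δ : ℝ≥0∞, 0 < δ ∧ ∀ x : Fn, (∀ᵐ t : I, |x t| ≤ 1) →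
    volume {t : I | 0 < |x t|} < δ → N x < ε

namespace IsRINorm

variable {N : Fn → ℝ≥0∞}

theorem tail_zero (hN : IsRINorm N) (x : Fn) : N (tail 0 x) = N x := by
  refine le_antisymm (hN.ideal _ _ ?_) (hN.ideal _ _ ?_) <;>
  · filter_upwards [coeFn_tail_zero x] with t ht
    simp [ht]

theorem le_add_of_abs_le (hN : IsRINorm N) {x y z : Fn} (h : ∀ᵐ t : I, |z t| ≤ |x t| + |y t|) :
    N z ≤ N x + N y := by
  rw [← hN.tail_zero x, ← hN.tail_zero y]
  refine (hN.ideal _ _ ?_).trans (hN.add_le _ _)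
  filter_upwards [h, coeFn_tail_zero x, coeFn_tail_zero y,
    AEEqFun.coeFn_add (tail 0 x) (tail 0 y)] with t h1 h2 h3 h4
  rw [h4, Pi.add_apply, h2, h3]
  exact h1.trans (le_abs_self _)

theorem le_mul_of_abs_le (hN : IsRINorm N) {c : ℝ} {x y : Fn}
    (h : ∀ᵐ t : I, |y t| ≤ c * |x t|) : N y ≤ ENNReal.ofReal c * N x := by
  rcases le_or_gt 0 c with hc | hc
  · rw [← Real.enorm_of_nonneg hc, ← hN.smul]
    refine hN.ideal _ _ ?_
    filter_upwards [h, AEEqFun.coeFn_smul c x] with t h1 h2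
    rwa [h2, Pi.smul_apply, smul_eq_mul, abs_mul, abs_of_nonneg hc]
  · have : N y ≤ N 0 := by
      refine hN.ideal _ _ ?_
      filter_upwards [h, AEEqFun.coeFn_zero (α := I) (β := ℝ)] with t h1 h2
      rw [h2]
      simp only [Pi.zero_apply, abs_zero]
      exact h1.trans (mul_nonpos_of_nonpos_of_nonneg hc.le (abs_nonneg _))
    rw [hN.map_zero] at this
    exact this.trans zero_le

theorem tail_le_tail (hN : IsRINorm N) {x y : Fn} {a b : ℝ} (hab : b ≤ a)
    (h : ∀ᵐ t : I, |x t| ≤ |y t|) : N (tail a x) ≤ N (tail b y) := by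
  refine hN.ideal _ _ ?_
  filter_upwards [h, abs_tail a x, abs_tail b y] with t h1 h2 h3
  rw [h2, h3]
  gcongr

theorem exists_tail_lt (hN : IsRINorm N) {x : Fn} (h : TailsVanish N x) {ε : ℝ≥0∞} (hε : 0 < ε) :
    ∃ n₀ : ℕ, ∀ a : ℝ, n₀ ≤ a → N (tail a x) < ε := by
  obtain ⟨n, hn⟩ := h ε hε
  exact ⟨n, fun a ha => (hN.tail_le_tail ha (ae_of_all _ fun _ => le_rfl)).trans_lt hn⟩

theorem tailsVanish_mono (hN : IsRINorm N) {x y : Fn} (h : ∀ᵐ t : I, |x t| ≤ |y t|)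
    (hy : TailsVanish N y) : TailsVanish N x := fun ε hε =>
  (hy ε hε).imp fun _ hn => (hN.tail_le_tail le_rfl h).trans_lt hn

theorem tailsVanish_of_bounded (hN : IsRINorm N) {x : Fn} {C : ℝ} (h : ∀ᵐ t : I, |x t| ≤ C) :
    TailsVanish N x := by
  intro ε hε
  obtain ⟨n, hn⟩ := exists_nat_ge C
  refine ⟨n, ?_⟩
  have : N (tail n x) ≤ N 0 := by
    refine hN.ideal _ _ ?_
    filter_upwards [h, coeFn_tail n x] with t h1 h2
    rw [h2, max_eq_right (by linarith)]
    simp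
  rw [hN.map_zero] at this
  exact this.trans_lt hε

theorem tailsVanish_of_approx (hN : IsRINorm N) {x : Fn}
    (h : ∀ ε : ℝ≥0∞, 0 < ε → ∃ y, TailsVanish N y ∧ N (x - y) < ε) : TailsVanish N x := by
  intro ε hε
  have hε2 : 0 < ε / 2 := ENNReal.half_pos hε.ne'
  obtain ⟨y, hy, hxy⟩ := h _ hε2
  obtain ⟨n, hn⟩ := hy _ hε2
  refine ⟨n, ?_⟩
  calc N (tail n x) ≤ N (x - y) + N (tail n y) := by
        refine hN.le_add_of_abs_le ?_
        filter_upwards [coeFn_tail n x, coeFn_tail n y, AEEqFun.coeFn_sub x y] with t h1 h2 h3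
        rw [h1, h2, h3, Pi.sub_apply]
        grind
    _ < ε / 2 + ε / 2 := ENNReal.add_lt_add hxy hn
    _ = ε := ENNReal.add_halves ε

theorem tailsVanish_add (hN : IsRINorm N) {x y : Fn} (hx : TailsVanish N x)
    (hy : TailsVanish N y) : TailsVanish N (x + y) := by
  intro ε hε
  have hε2 : 0 < ε / 2 := ENNReal.half_pos hε.ne'
  obtain ⟨m, hm⟩ := hx _ hε2
  obtain ⟨n, hn⟩ := hy _ hε2
  refine ⟨m + n, ?_⟩
  calc N (tail (m + n : ℕ) (x + y)) ≤ N (tail m x) + N (tail n y) := by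
        refine hN.le_add_of_abs_le ?_
        filter_upwards [abs_tail m x, abs_tail n y, abs_tail (m + n : ℕ) (x + y),
          AEEqFun.coeFn_add x y] with t h1 h2 h3 h4
        rw [h1, h2, h3, h4, Pi.add_apply]
        push_cast
        refine max_le ?_ (by positivity)
        linarith [abs_add_le (x t) (y t), le_max_left (|x t| - m) 0, le_max_left (|y t| - n) 0]
    _ < ε / 2 + ε / 2 := ENNReal.add_lt_add hm hn
    _ = ε := ENNReal.add_halves ε

theorem tailsVanish_smul (hN : IsRINorm N) (c : ℝ) {x : Fn} (hx : TailsVanish N x) :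
    TailsVanish N (c • x) := by
  intro ε hε
  obtain ⟨k, hk⟩ := exists_nat_ge |c|
  obtain ⟨δ, hδ, hδε⟩ := ENNReal.exists_nnreal_pos_mul_lt (ENNReal.natCast_ne_top k) hε.ne'
  obtain ⟨n, hn⟩ := hx δ (by exact_mod_cast hδ)
  refine ⟨k * n, lt_of_le_of_lt ?_ hδε⟩
  calc N (tail (k * n : ℕ) (c • x)) ≤ ENNReal.ofReal k * N (tail n x) := by
        refine hN.le_mul_of_abs_le ?_
        filter_upwards [abs_tail n x, abs_tail (k * n : ℕ) (c • x),
          AEEqFun.coeFn_smul c x] with t h1 h2 h3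
        rw [h1, h2, h3, Pi.smul_apply, smul_eq_mul, abs_mul,
          mul_max_of_nonneg _ _ (by positivity), mul_sub]
        push_cast
        gcongr
        simp
    _ ≤ k * δ := by
        rw [ENNReal.ofReal_natCast]
        gcongr
    _ = δ * k := mul_comm _ _

theorem lt_top_of_tailsVanish (hN : IsRINorm N) {x : Fn} (hx : TailsVanish N x) : N x < ∞ := by
  obtain ⟨n, hn⟩ := hx 1 one_pos
  refine (hN.le_add_of_abs_le (x := tail n x) (y := (n : ℝ) • 1) ?_).trans_lt
    (ENNReal.add_lt_top.2 ⟨hn.trans ENNReal.one_lt_top, ?_⟩)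
  · filter_upwards [abs_tail n x, AEEqFun.coeFn_smul (n : ℝ) (1 : Fn)] with t h1 h2
    rw [h1, h2]
    simp only [Pi.smul_apply, AEEqFun.coeFn_one_eq, smul_eq_mul, mul_one, Nat.abs_cast]
    linarith [le_max_left (|x t| - n) 0]
  · rw [hN.smul]
    exact ENNReal.mul_lt_top (by simp) hN.one_lt_top

theorem tailsVanish_iff (hN : IsRINorm N) (x : Fn) :
    (∀ ε : ℝ≥0∞, 0 < ε → ∃ y ∈ Lp ℝ ∞ (volume : Measure I), N (x - y) < ε) ↔ TailsVanish N x := by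
  constructor
  · intro h
    refine hN.tailsVanish_of_approx fun ε hε => ?_
    obtain ⟨y, hy, hxy⟩ := h ε hε
    refine ⟨y, hN.tailsVanish_of_bounded
      (C := (eLpNormEssSup y (volume : Measure I)).toReal) ?_, hxy⟩
    have hfin : eLpNormEssSup y (volume : Measure I) ≠ ∞ := by
      have := Lp.mem_Lp_iff_eLpNorm_lt_top.1 hy
      rw [eLpNorm_exponent_top] at this
      exact this.ne
    filter_upwards [ae_le_eLpNormEssSup (f := y) (μ := (volume : Measure I))] with t ht
    have := ENNReal.toReal_mono hfin ht
    simpa using this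
  · intro h ε hε
    obtain ⟨n, hn⟩ := h ε hε
    refine ⟨clamp n x, ?_, ?_⟩
    · rw [Lp.mem_Lp_iff_memLp]
      exact memLp_top_of_bound (clamp n x).aestronglyMeasurable n
        (abs_clamp_le (Nat.cast_nonneg n) x)
    · refine (hN.ideal _ _ ?_).trans_lt hn
      filter_upwards [abs_sub_clamp (Nat.cast_nonneg n) x] with t ht using ht.le

theorem separablePartNorm_of_tailsVanish (hN : IsRINorm N) {x : Fn} (hx : TailsVanish N x) :
    separablePartNorm N x = N x :=
  if_pos ((hN.tailsVanish_iff x).2 hx)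

theorem separablePartNorm_of_not_tailsVanish (hN : IsRINorm N) {x : Fn} (hx : ¬ TailsVanish N x) :
    separablePartNorm N x = ∞ :=
  if_neg fun h => hx ((hN.tailsVanish_iff x).1 h)

theorem separablePartNorm_lt_top_iff (hN : IsRINorm N) {x : Fn} :
    separablePartNorm N x < ∞ ↔ TailsVanish N x := by
  by_cases hx : TailsVanish N x
  · simp [hN.separablePartNorm_of_tailsVanish hx, hx, hN.lt_top_of_tailsVanish hx]
  · simp [hN.separablePartNorm_of_not_tailsVanish hx, hx]

theorem le_separablePartNorm (hN : IsRINorm N) (x : Fn) : N x ≤ separablePartNorm N x := by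
  by_cases hx : TailsVanish N x
  · rw [hN.separablePartNorm_of_tailsVanish hx]
  · simp [hN.separablePartNorm_of_not_tailsVanish hx]

theorem tailsVanish_smul_iff (hN : IsRINorm N) {c : ℝ} (hc : c ≠ 0) {x : Fn} :
    TailsVanish N (c • x) ↔ TailsVanish N x := by
  refine ⟨fun h => ?_, hN.tailsVanish_smul c⟩
  simpa [smul_smul, hc] using hN.tailsVanish_smul c⁻¹ h

theorem tailsVanish_congr (hN : IsRINorm N) {x y : Fn} (h : Equimeasurable x y)
    (hy : TailsVanish N y) : TailsVanish N x := fun ε hε =>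
  (hy ε hε).imp fun n hn => by rwa [hN.symmetric _ _ (h.tail n.cast_nonneg)]

/-- The ideal property and the symmetry are inherited because `(|x| - n)⁺` is the smallest
difference, in absolute value, of `x` and a function bounded by `n`. -/
theorem isRINorm_separablePartNorm (hN : IsRINorm N) : IsRINorm (separablePartNorm N) where
  add_le x y := by
    by_cases hx : TailsVanish N x
    · by_cases hy : TailsVanish N y
      · rw [hN.separablePartNorm_of_tailsVanish hx, hN.separablePartNorm_of_tailsVanish hy,
          hN.separablePartNorm_of_tailsVanish (hN.tailsVanish_add hx hy)]
        exact hN.add_le x y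
      · simp [hN.separablePartNorm_of_not_tailsVanish hy]
    · simp [hN.separablePartNorm_of_not_tailsVanish hx]
  smul c x := by
    rcases eq_or_ne c 0 with rfl | hc
    · have h0 : TailsVanish N 0 := hN.tailsVanish_of_bounded (C := 0) <| by
        filter_upwards [AEEqFun.coeFn_zero (α := I) (β := ℝ)] with t ht
        simp [ht]
      simp [hN.separablePartNorm_of_tailsVanish h0, hN.map_zero]
    by_cases hx : TailsVanish N x
    · rw [hN.separablePartNorm_of_tailsVanish hx,
        hN.separablePartNorm_of_tailsVanish (hN.tailsVanish_smul c hx), hN.smul]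
    · rw [hN.separablePartNorm_of_not_tailsVanish hx, hN.separablePartNorm_of_not_tailsVanish
        (mt (hN.tailsVanish_smul_iff hc).1 hx), ENNReal.mul_top (by simpa using hc)]
  eq_zero x hx := hN.eq_zero x <| nonpos_iff_eq_zero.1 <| hx ▸ hN.le_separablePartNorm x
  complete u hu hcauchy := by
    have hu' : ∀ n, TailsVanish N (u n) := fun n => hN.separablePartNorm_lt_top_iff.1 (hu n)
    obtain ⟨x, -, hlim⟩ := hN.complete u (fun n => hN.lt_top_of_tailsVanish (hu' n))
      fun ε hε => (hcauchy ε hε).imp fun n₀ h m hm n hn =>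
        (hN.le_separablePartNorm _).trans_lt (h m hm n hn)
    have hx : TailsVanish N x := hN.tailsVanish_of_approx fun ε hε => by
      obtain ⟨n, hn⟩ := (hlim.eventually_lt_const hε).exists
      exact ⟨u n, hu' n, by rwa [hN.sub_comm]⟩
    refine ⟨x, hN.separablePartNorm_lt_top_iff.2 hx, hlim.congr fun n => ?_⟩
    rw [hN.separablePartNorm_of_tailsVanish]
    simpa [sub_eq_add_neg] using hN.tailsVanish_add (hu' n) (hN.tailsVanish_smul (-1) hx)
  nontrivial := by
    -- `1` is not the class of `0`, since constant classes are represented by constant functions.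
    refine ⟨1, fun h => ?_, hN.separablePartNorm_lt_top_iff.2
      (hN.tailsVanish_of_bounded (C := 1) (ae_of_all _ fun t => by simp))⟩
    have h1 : (1 : Fn) (0 : I) = 1 := AEEqFun.coeFn_one_eq
    rw [h] at h1
    have h2 : (0 : Fn) (0 : I) = 0 := AEEqFun.coeFn_zero_eq
    simp [h2] at h1
  ideal x y h := by
    by_cases hy : TailsVanish N y
    · rw [hN.separablePartNorm_of_tailsVanish hy,
        hN.separablePartNorm_of_tailsVanish (hN.tailsVanish_mono h hy)]
      exact hN.ideal x y h
    · simp [hN.separablePartNorm_of_not_tailsVanish hy]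
  symmetric x y h := by
    by_cases hy : TailsVanish N y
    · rw [hN.separablePartNorm_of_tailsVanish hy,
        hN.separablePartNorm_of_tailsVanish (hN.tailsVanish_congr h hy)]
      exact hN.symmetric x y h
    · rw [hN.separablePartNorm_of_not_tailsVanish hy, hN.separablePartNorm_of_not_tailsVanish
        fun hx => hy (hN.tailsVanish_congr h.symm hx)]

/-- On functions bounded by a common constant, convergence in measure implies convergence in a
support continuous r.i. norm. -/
theorem exists_lt_of_bounded (hN : IsRINorm N) (hc : SupportContinuous N) (C : ℝ) {ε : ℝ≥0∞}
    (hε : 0 < ε) : ∃ η : ℝ, 0 < η ∧ ∃ δ : ℝ≥0∞, 0 < δ ∧ ∀ w : Fn, (∀ᵐ t : I, |w t| ≤ C) →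
      volume {t : I | η < |w t|} < δ → N w < ε := by
  have hε2 : 0 < ε / 2 := ENNReal.half_pos hε.ne'
  obtain ⟨η, hη, hη'⟩ := ENNReal.exists_nnreal_pos_mul_lt hN.one_lt_top.ne hε2.ne'
  obtain ⟨κ, hκ, hκ'⟩ := ENNReal.exists_nnreal_pos_mul_lt
    (ENNReal.ofReal_ne_top (r := |C| + 1)) hε2.ne'
  obtain ⟨δ, hδ, h⟩ := hc κ (by exact_mod_cast hκ)
  have hC : 0 < |C| + 1 := by positivity
  refine ⟨η, by exact_mod_cast hη, δ, hδ, fun w hw hv => ?_⟩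
  have hv' : N ((|C| + 1)⁻¹ • tail η w) < κ := by
    refine h _ ?_ (lt_of_le_of_lt (measure_mono_ae (μ := (volume : Measure I)) ?_) hv)
    · filter_upwards [hw, abs_tail η w, AEEqFun.coeFn_smul (|C| + 1)⁻¹ (tail η w)] with t h1 h2 h3
      rw [h3, Pi.smul_apply, smul_eq_mul, abs_mul, h2, abs_of_pos (by positivity),
        inv_mul_le_iff₀ hC]
      refine max_le ?_ (by positivity)
      linarith [le_abs_self C, η.coe_nonneg]
    · filter_upwards [abs_tail η w, AEEqFun.coeFn_smul (|C| + 1)⁻¹ (tail η w)] with t h2 h3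
      intro (h4 : 0 < |((|C| + 1)⁻¹ • tail η w : Fn) t|)
      rw [h3, Pi.smul_apply, smul_eq_mul, abs_mul, h2, abs_of_pos (by positivity)] at h4
      have := pos_of_mul_pos_right h4 (by positivity)
      rw [lt_max_iff] at this
      change (η : ℝ) < |w t|
      rcases this with h | h
      · linarith
      · exact absurd h (lt_irrefl _)
  calc N w ≤ N ((η : ℝ) • 1) + N (tail η w) := by
        refine hN.le_add_of_abs_le ?_
        filter_upwards [abs_tail η w, AEEqFun.coeFn_smul (η : ℝ) (1 : Fn)] with t h1 h2
        rw [h1, h2]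
        simp only [Pi.smul_apply, AEEqFun.coeFn_one_eq, smul_eq_mul, mul_one, NNReal.abs_eq]
        linarith [le_max_left (|w t| - η) 0]
    _ ≤ η * N 1 + κ * ENNReal.ofReal (|C| + 1) := by
        refine add_le_add ?_ ?_
        · rw [hN.smul, Real.enorm_of_nonneg η.coe_nonneg]
          simp
        · have h5 : tail η w = (|C| + 1) • ((|C| + 1)⁻¹ • tail η w) := by
            rw [smul_smul, mul_inv_cancel₀ hC.ne', one_smul]
          rw [h5, hN.smul, Real.enorm_of_nonneg hC.le, mul_comm]
          gcongr
    _ < ε / 2 + ε / 2 := ENNReal.add_lt_add hη' hκ'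
    _ = ε := ENNReal.add_halves ε

/-- The truncations of the elements of a countable dense subset of `L₁` are dense in the closure
of `L_∞`. -/
theorem isSeparableNorm_separablePartNorm (hN : IsRINorm N) (hc : SupportContinuous N) :
    IsSeparableNorm (separablePartNorm N) := by
  have : Fact ((1 : ℝ≥0∞) ≠ ∞) := ⟨ENNReal.one_ne_top⟩
  obtain ⟨D, hD, hdense⟩ := TopologicalSpace.exists_countable_dense
    (Lp ℝ 1 (volume : Measure I))
  refine ⟨(fun p : ℕ × Lp ℝ 1 (volume : Measure I) => clamp p.1 p.2) '' (Set.univ ×ˢ D),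
    (Set.countable_univ.prod hD).image _, ?_, ?_⟩
  · rintro _ ⟨⟨n, d⟩, -, rfl⟩
    exact hN.separablePartNorm_lt_top_iff.2
      (hN.tailsVanish_of_bounded (abs_clamp_le n.cast_nonneg d.1))
  intro x hx ε hε
  replace hx : TailsVanish N x := hN.separablePartNorm_lt_top_iff.1 hx
  have hε2 : 0 < ε / 2 := ENNReal.half_pos hε.ne'
  obtain ⟨n, hn⟩ := hx _ hε2
  have hn0 : (0 : ℝ) ≤ n := n.cast_nonneg
  obtain ⟨η, hη, δ, hδ, h⟩ := hN.exists_lt_of_bounded hc (2 * n) hε2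
  have hmem : MemLp (clamp n x) 1 (volume : Measure I) :=
    (memLp_top_of_bound (clamp n x).aestronglyMeasurable n
        (abs_clamp_le hn0 x)).mono_exponent le_top
  let y : Lp ℝ 1 (volume : Measure I) := hmem.toLp
  have hy : ∀ᵐ t : I, y t = clamp n x t := hmem.coeFn_toLp
  obtain ⟨ρ, hρ, hρδ⟩ := ENNReal.exists_nnreal_pos_mul_lt
    (ENNReal.ofReal_ne_top (r := η⁻¹)) hδ.ne'
  obtain ⟨d, hdD, hd⟩ := hdense.exists_dist_lt y (ε := ρ) (by exact_mod_cast hρ)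
  have hcd : ∀ᵐ t : I, |(clamp n x - clamp n d.1) t| ≤ |(y - d) t| := by
    filter_upwards [hy, coeFn_clamp n x, coeFn_clamp n d.1,
      AEEqFun.coeFn_sub (clamp n x) (clamp n d.1), Lp.coeFn_sub y d] with t h1 h2 h3 h4 h5
    rw [h4, h5, Pi.sub_apply, Pi.sub_apply, h1, h2, h3]
    grind
  refine ⟨clamp n d.1, ⟨(n, d), ⟨trivial, hdD⟩, rfl⟩, ?_⟩
  have hvan : TailsVanish N (x - clamp n d.1) := by
    have := hN.tailsVanish_smul (-1) (hN.tailsVanish_of_bounded (abs_clamp_le hn0 d.1))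
    simpa [sub_eq_add_neg] using hN.tailsVanish_add hx this
  rw [hN.separablePartNorm_of_tailsVanish hvan]
  calc N (x - clamp n d.1) ≤ N (x - clamp n x) + N (clamp n x - clamp n d.1) := by
        simpa using hN.add_le (x - clamp n x) (clamp n x - clamp n d.1)
    _ < ε / 2 + ε / 2 := by
        refine ENNReal.add_lt_add ((hN.ideal _ _ ?_).trans_lt hn) (h _ ?_ ?_)
        · filter_upwards [abs_sub_clamp hn0 x] with t ht using ht.le
        · filter_upwards [abs_clamp_le hn0 x, abs_clamp_le hn0 d.1,
            AEEqFun.coeFn_sub (clamp n x) (clamp n d.1)] with t h1 h2 h3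
          rw [h3, Pi.sub_apply]
          linarith [abs_sub (clamp n x t) (clamp n d.1 t)]
        · have hnorm : ∫⁻ t : I, ‖(y - d) t‖ₑ < ρ := by
            rw [← eLpNorm_one_eq_lintegral_enorm, ← Lp.enorm_def, ← ofReal_norm,
              ← dist_eq_norm]
            rw [← ENNReal.ofReal_coe_nnreal]
            exact (ENNReal.ofReal_lt_ofReal_iff (by exact_mod_cast hρ)).2 hd
          calc volume {t : I | η < |(clamp n x - clamp n d.1) t|}
              ≤ volume {t : I | ENNReal.ofReal η ≤ ‖(y - d) t‖ₑ} := by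
                refine measure_mono_ae (μ := (volume : Measure I)) ?_
                filter_upwards [hcd] with t h1
                intro (h2 : η < |(clamp n x - clamp n d.1) t|)
                change ENNReal.ofReal η ≤ ‖(y - d) t‖ₑ
                rw [← ofReal_norm, Real.norm_eq_abs]
                exact ENNReal.ofReal_le_ofReal (h2.le.trans h1)
            _ ≤ (∫⁻ t : I, ‖(y - d) t‖ₑ) / ENNReal.ofReal η :=
                meas_ge_le_lintegral_div (Lp.aestronglyMeasurable _).enorm
                  (by simpa using hη) ENNReal.ofReal_ne_top
            _ = (∫⁻ t : I, ‖(y - d) t‖ₑ) * ENNReal.ofReal η⁻¹ := by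
                rw [ENNReal.div_eq_inv_mul, mul_comm, ENNReal.ofReal_inv_of_pos hη]
            _ ≤ ρ * ENNReal.ofReal η⁻¹ := by gcongr
            _ < δ := hρδ
    _ = ε := ENNReal.add_halves ε

end IsRINorm

/-- The closure of `L_∞` in the space with extended norm `N`, as an r.i. space. -/
def separablePart (N : Fn → ℝ≥0∞) (hN : IsRINorm N) (hc : SupportContinuous N) : RISpace where
  enorm := separablePartNorm N
  enorm_add_le := hN.isRINorm_separablePartNorm.add_le
  enorm_smul := hN.isRINorm_separablePartNorm.smul
  eq_zero_of_enorm := hN.isRINorm_separablePartNorm.eq_zero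
  complete := hN.isRINorm_separablePartNorm.complete
  nontrivial := hN.isRINorm_separablePartNorm.nontrivial
  ideal := hN.isRINorm_separablePartNorm.ideal
  symmetric := hN.isRINorm_separablePartNorm.symmetric
  separable_or_maximal := Or.inl (hN.isSeparableNorm_separablePartNorm hc)

/-! ### Norms given by a unit ball -/

/-- The gauge `inf {c > 0 : x / c ∈ B}` of the set `B`, with value `∞` if there is no such `c`. -/
def gaugeNorm (B : Set Fn) (x : Fn) : ℝ≥0∞ :=
  ⨅ (c : ℝ) (_ : 0 < c) (_ : c⁻¹ • x ∈ B), ENNReal.ofReal c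

/-- The properties of `B` which make its gauge an r.i. norm: `B` is a convex, solid, rearrangement
invariant set that contains a multiple of `1`, and it is contained in the unit ball of `N` and
closed with respect to `N`. -/
structure IsUnitBall (N : Fn → ℝ≥0∞) (B : Set Fn) : Prop where
  convex : ∀ x ∈ B, ∀ y ∈ B, ∀ a b : ℝ, 0 ≤ a → 0 ≤ b → a + b = 1 → a • x + b • y ∈ B
  solid : ∀ x y : Fn, (∀ᵐ t : I, |x t| ≤ |y t|) → y ∈ B → x ∈ B
  symmetric : ∀ x y : Fn, Equimeasurable x y → y ∈ B → x ∈ B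
  absorbs_one : ∃ c : ℝ, 0 < c ∧ c • (1 : Fn) ∈ B
  le_one : ∀ x ∈ B, N x ≤ 1
  closed : ∀ (v : ℕ → Fn) (x : Fn), (∀ m, v m ∈ B) →
    Tendsto (fun m => N (v m - x)) atTop (𝓝 0) → x ∈ B

theorem gaugeNorm_le {B : Set Fn} {x : Fn} {c : ℝ} (hc : 0 < c) (h : c⁻¹ • x ∈ B) :
    gaugeNorm B x ≤ ENNReal.ofReal c :=
  iInf_le_of_le c <| iInf_le_of_le hc <| iInf_le_of_le h le_rfl

theorem exists_smul_mem_of_gaugeNorm_lt {B : Set Fn} {x : Fn} {a : ℝ≥0∞}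
    (h : gaugeNorm B x < a) : ∃ c : ℝ, 0 < c ∧ c⁻¹ • x ∈ B ∧ ENNReal.ofReal c < a := by
  obtain ⟨c, h⟩ := iInf_lt_iff.1 h
  obtain ⟨hc, h⟩ := iInf_lt_iff.1 h
  obtain ⟨hB, h⟩ := iInf_lt_iff.1 h
  exact ⟨c, hc, hB, h⟩

namespace IsUnitBall

variable {N : Fn → ℝ≥0∞} {B : Set Fn}

theorem smul_mem (hB : IsUnitBall N B) {a b : ℝ} (hab : |a| ≤ |b|) {x : Fn} (h : b • x ∈ B) :
    a • x ∈ B := by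
  refine hB.solid _ _ ?_ h
  filter_upwards [AEEqFun.coeFn_smul a x, AEEqFun.coeFn_smul b x] with t h1 h2
  rw [h1, h2]
  simp only [Pi.smul_apply, smul_eq_mul, abs_mul]
  gcongr

theorem smul_mem_of_gaugeNorm_lt (hB : IsUnitBall N B) {x : Fn} {c : ℝ} (hc : 0 < c)
    (h : gaugeNorm B x < ENNReal.ofReal c) : c⁻¹ • x ∈ B := by
  obtain ⟨d, hd, hdB, hdc⟩ := exists_smul_mem_of_gaugeNorm_lt h
  refine hB.smul_mem ?_ hdB
  rw [abs_of_pos (inv_pos.2 hc), abs_of_pos (inv_pos.2 hd)]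
  gcongr
  exact ((ENNReal.ofReal_lt_ofReal_iff hc).1 hdc).le

theorem add_le (hB : IsUnitBall N B) (x y : Fn) :
    gaugeNorm B (x + y) ≤ gaugeNorm B x + gaugeNorm B y := by
  refine ENNReal.le_of_forall_pos_le_add fun ε hε hfin => ?_
  have hε2 : ((ε / 2 : ℝ≥0) : ℝ≥0∞) ≠ 0 := by simpa using hε.ne'
  obtain ⟨hx, hy⟩ := ENNReal.add_lt_top.1 hfin
  obtain ⟨a, ha, haB, hax⟩ := exists_smul_mem_of_gaugeNorm_lt (ENNReal.lt_add_right hx.ne hε2)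
  obtain ⟨b, hb, hbB, hby⟩ := exists_smul_mem_of_gaugeNorm_lt (ENNReal.lt_add_right hy.ne hε2)
  have hmem : (a + b)⁻¹ • (x + y) ∈ B := by
    have := hB.convex _ haB _ hbB (a / (a + b)) (b / (a + b)) (by positivity) (by positivity)
      (by field_simp)
    rw [smul_smul, smul_smul] at this
    convert this using 1
    rw [smul_add]
    congr 2 <;> field_simp
  refine (gaugeNorm_le (by positivity) hmem).trans ?_
  rw [ENNReal.ofReal_add ha.le hb.le]
  refine (add_le_add hax.le hby.le).trans ?_
  rw [add_add_add_comm, ← ENNReal.coe_add, add_halves]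

theorem zero_mem (hB : IsUnitBall N B) : (0 : Fn) ∈ B := by
  obtain ⟨c, -, h⟩ := hB.absorbs_one
  simpa using hB.smul_mem (a := 0) (by simp) h

theorem map_zero (hB : IsUnitBall N B) : gaugeNorm B 0 = 0 := by
  refine nonpos_iff_eq_zero.1 (ENNReal.le_of_forall_pos_le_add fun ε hε _ => ?_)
  refine (gaugeNorm_le (c := ε) (by exact_mod_cast hε) (by simpa using hB.zero_mem)).trans ?_
  simp

theorem smul_le (hB : IsUnitBall N B) {c : ℝ} (hc : c ≠ 0) (x : Fn) :
    gaugeNorm B (c • x) ≤ ‖c‖ₑ * gaugeNorm B x := by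
  have hc0 : ‖c‖ₑ ≠ 0 := by simpa using hc
  simp_rw [gaugeNorm, ENNReal.mul_iInf_of_ne hc0 enorm_ne_top]
  refine le_iInf fun d => le_iInf fun hd => le_iInf fun h => ?_
  have hcd : 0 < |c| * d := mul_pos (abs_pos.2 hc) hd
  have hmem : (|c| * d)⁻¹ • (c • x) ∈ B := by
    rw [smul_smul]
    refine hB.smul_mem (le_of_eq ?_) h
    rw [mul_inv, abs_mul, abs_mul, abs_inv, abs_abs]
    field_simp [abs_ne_zero.2 hc]
  refine (gaugeNorm_le hcd hmem).trans (le_of_eq ?_)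
  rw [ENNReal.ofReal_mul (abs_nonneg c), ← Real.norm_eq_abs, ofReal_norm]

theorem map_smul (hB : IsUnitBall N B) (c : ℝ) (x : Fn) :
    gaugeNorm B (c • x) = ‖c‖ₑ * gaugeNorm B x := by
  rcases eq_or_ne c 0 with rfl | hc
  · simp [hB.map_zero]
  refine le_antisymm (hB.smul_le hc x) ?_
  have h := hB.smul_le (inv_ne_zero hc) (c • x)
  rw [smul_smul, inv_mul_cancel₀ hc, one_smul] at h
  calc ‖c‖ₑ * gaugeNorm B x ≤ ‖c‖ₑ * (‖c⁻¹‖ₑ * gaugeNorm B (c • x)) := by gcongr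
    _ = gaugeNorm B (c • x) := by
      rw [← mul_assoc, ← enorm_mul, mul_inv_cancel₀ hc, enorm_one, one_mul]

theorem le_gaugeNorm (hB : IsUnitBall N B) (hsmul : ∀ (c : ℝ) x, N (c • x) = ‖c‖ₑ * N x)
    (x : Fn) : N x ≤ gaugeNorm B x := by
  refine le_iInf fun c => le_iInf fun hc => le_iInf fun h => ?_
  have hx : x = c • (c⁻¹ • x) := by rw [smul_smul, mul_inv_cancel₀ hc.ne', one_smul]
  rw [hx, hsmul, Real.enorm_of_nonneg hc.le]
  exact mul_le_of_le_one_right' (hB.le_one _ h)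

/-- A Cauchy sequence converges with respect to `N`, and the closedness of the multiples of `B`
turns the Cauchy condition into convergence with respect to the gauge. -/
theorem isCompleteNorm (hB : IsUnitBall N B) (hsmul : ∀ (c : ℝ) x, N (c • x) = ‖c‖ₑ * N x)
    (hcomplete : IsCompleteNorm N) : IsCompleteNorm (gaugeNorm B) := by
  have hle := hB.le_gaugeNorm hsmul
  intro u hu hcauchy
  obtain ⟨x, -, hlim⟩ := hcomplete u (fun n => (hle _).trans_lt (hu n)) fun ε hε =>
    (hcauchy ε hε).imp fun n₀ h m hm n hn => (hle _).trans_lt (h m hm n hn)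
  have key : ∀ ε : ℝ≥0∞, 0 < ε → ∃ n₀ : ℕ, ∀ n ≥ n₀, gaugeNorm B (u n - x) ≤ ε := by
    intro ε hε
    obtain ⟨r, hr, hrε⟩ := ENNReal.lt_iff_exists_nnreal_btwn.1 hε
    have hr0 : (0 : ℝ) < r := by exact_mod_cast hr
    obtain ⟨n₀, h⟩ := hcauchy r hr
    refine ⟨n₀, fun n hn => le_trans (gaugeNorm_le hr0 ?_) ((by simpa using hrε.le))⟩
    refine hB.closed (fun m => (r : ℝ)⁻¹ • (u n - u (n₀ + m))) _ (fun m => ?_) ?_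
    · exact hB.smul_mem_of_gaugeNorm_lt hr0 (by simpa using h n hn (n₀ + m) (by omega))
    · have h1 : ∀ m, N ((r : ℝ)⁻¹ • (u n - u (n₀ + m)) - (r : ℝ)⁻¹ • (u n - x)) =
          ‖(-(r : ℝ)⁻¹)‖ₑ * N (u (m + n₀) - x) := by
        intro m
        rw [← hsmul, ← smul_sub, sub_sub_sub_cancel_left, neg_smul, ← smul_neg, neg_sub,
          add_comm]
      simp_rw [h1]
      have h2 := (tendsto_add_atTop_iff_nat n₀).2 hlim
      simpa using ENNReal.Tendsto.const_mul h2 (Or.inr (enorm_ne_top (x := -(r : ℝ)⁻¹)))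
  refine ⟨x, ?_, ENNReal.tendsto_atTop_zero.2 key⟩
  obtain ⟨n, hn⟩ := key 1 one_pos
  have h1 : gaugeNorm B x ≤ gaugeNorm B (u n) + ‖(-1 : ℝ)‖ₑ * gaugeNorm B (u n - x) := by
    rw [← hB.map_smul]
    simpa using hB.add_le (u n) ((-1 : ℝ) • (u n - x))
  refine h1.trans_lt (ENNReal.add_lt_top.2 ⟨hu n, ?_⟩)
  exact ENNReal.mul_lt_top (by simp) ((hn n le_rfl).trans_lt ENNReal.one_lt_top)

theorem isRINorm_gaugeNorm (hB : IsUnitBall N B)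
    (hsmul : ∀ (c : ℝ) x, N (c • x) = ‖c‖ₑ * N x) (hzero : ∀ x, N x = 0 → x = 0)
    (hcomplete : IsCompleteNorm N) : IsRINorm (gaugeNorm B) where
  add_le := hB.add_le
  smul := hB.map_smul
  eq_zero x hx := hzero x <| nonpos_iff_eq_zero.1 <| hx ▸ hB.le_gaugeNorm hsmul x
  complete := hB.isCompleteNorm hsmul hcomplete
  nontrivial := by
    obtain ⟨c, hc, h⟩ := hB.absorbs_one
    refine ⟨1, fun h => ?_, (gaugeNorm_le (inv_pos.2 hc)
      (by rwa [inv_inv])).trans_lt ENNReal.ofReal_lt_top⟩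
    have h1 : (1 : Fn) (0 : I) = 1 := AEEqFun.coeFn_one_eq
    rw [h] at h1
    have h2 : (0 : Fn) (0 : I) = 0 := AEEqFun.coeFn_zero_eq
    simp [h2] at h1
  ideal x y h := by
    refine le_iInf fun c => le_iInf fun hc => le_iInf fun hy => gaugeNorm_le hc ?_
    refine hB.solid _ _ ?_ hy
    filter_upwards [h, AEEqFun.coeFn_smul c⁻¹ x, AEEqFun.coeFn_smul c⁻¹ y] with t h0 h1 h2
    rw [h1, h2]
    simp only [Pi.smul_apply, smul_eq_mul, abs_mul]
    gcongr
  symmetric := by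
    have key : ∀ x y, Equimeasurable x y → gaugeNorm B x ≤ gaugeNorm B y := by
      intro x y h
      refine le_iInf fun c => le_iInf fun hc => le_iInf fun hy => gaugeNorm_le hc ?_
      exact hB.symmetric _ _ (h.smul c⁻¹) hy
    exact fun x y h => le_antisymm (key x y h) (key y x h.symm)

end IsUnitBall

/-! ### Boundedness of monotone homogeneous functionals -/

namespace IsRINorm

variable {N : Fn → ℝ≥0∞}

/-- A gliding hump argument: if `T` is unbounded on the unit ball, the sum of a fast decreasing
sequence of nonnegative functions `v n` with `T (v n)` large is an element of the space at which
`T` is infinite. -/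
theorem exists_forall_le_of_forall_lt_top (hN : IsRINorm N) {T : Fn → ℝ≥0∞}
    (hmono : ∀ x y : Fn, (∀ᵐ t : I, |x t| ≤ |y t|) → T x ≤ T y)
    (hsmul : ∀ (c : ℝ) x, T (c • x) = ‖c‖ₑ * T x) (hT : ∀ x, N x < ∞ → T x < ∞) :
    ∃ C : ℝ≥0, ∀ x, N x ≤ 1 → T x ≤ C := by
  by_contra! hcon
  have hcon' : ∀ n : ℕ, ∃ x : Fn, N x ≤ 1 ∧ (2 ^ (n + 1) * n : ℝ≥0∞) < T x := fun n => by
    obtain ⟨x, h1, h2⟩ := hcon (2 ^ (n + 1) * n)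
    exact ⟨x, h1, by simpa using h2⟩
  choose u hu1 huT using hcon'
  -- `tail 0 (u n)` is `|u n|`.
  let v : ℕ → Fn := fun n => ((2 : ℝ)⁻¹ ^ (n + 1)) • tail 0 (u n)
  have hv : ∀ n, ∀ᵐ t : I, 0 ≤ v n t := by
    intro n
    filter_upwards [coeFn_tail_zero (u n),
      AEEqFun.coeFn_smul ((2 : ℝ)⁻¹ ^ (n + 1)) (tail 0 (u n))] with t h1 h2
    rw [h2, Pi.smul_apply, smul_eq_mul, h1]
    positivity
  have h2 : ∀ n : ℕ, ‖((2 : ℝ)⁻¹ ^ (n + 1))‖ₑ = (2⁻¹ : ℝ≥0∞) ^ (n + 1) := by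
    intro n
    rw [enorm_pow, enorm_inv two_ne_zero]
    congr 2
    rw [Real.enorm_of_nonneg (by norm_num)]
    simp
  have hvN : ∀ n, N (v n) ≤ 2⁻¹ ^ (n + 1) := by
    intro n
    rw [hN.smul, h2, hN.tail_zero]
    exact mul_le_of_le_one_right' (hu1 n)
  have hvT : ∀ n : ℕ, (n : ℝ≥0∞) ≤ T (v n) := by
    intro n
    have h3 : T (u n) ≤ T (tail 0 (u n)) := by
      refine hmono _ _ ?_
      filter_upwards [coeFn_tail_zero (u n)] with t ht
      simp [ht]
    rw [hsmul, h2]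
    calc (n : ℝ≥0∞) = 2⁻¹ ^ (n + 1) * (2 ^ (n + 1) * n) := by
          rw [← mul_assoc, ← mul_pow, ENNReal.inv_mul_cancel two_ne_zero ENNReal.ofNat_ne_top]
          simp
      _ ≤ 2⁻¹ ^ (n + 1) * T (tail 0 (u n)) := by
          gcongr
          exact (huT n).le.trans h3
  let S : ℕ → Fn := fun m => ∑ i ∈ Finset.range m, v i
  have hS : ∀ k m, k ≤ m → N (S m - S k) + 2⁻¹ ^ m ≤ 2⁻¹ ^ k := by
    intro k m hkm
    induction m, hkm using Nat.le_induction with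
    | base => simp [hN.map_zero]
    | succ m hkm ih =>
      have h3 : S (m + 1) - S k = (S m - S k) + v m := by
        simp only [S, Finset.sum_range_succ]
        abel
      have h4 : (2⁻¹ : ℝ≥0∞) ^ (m + 1) + 2⁻¹ ^ (m + 1) = 2⁻¹ ^ m := by
        rw [pow_succ, ← mul_add, ENNReal.inv_two_add_inv_two, mul_one]
      calc N (S (m + 1) - S k) + 2⁻¹ ^ (m + 1)
          ≤ (N (S m - S k) + 2⁻¹ ^ (m + 1)) + 2⁻¹ ^ (m + 1) := by
            rw [h3]
            gcongr
            exact (hN.add_le _ _).trans (by gcongr; exact hvN m)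
        _ = N (S m - S k) + 2⁻¹ ^ m := by rw [add_assoc, h4]
        _ ≤ 2⁻¹ ^ k := ih
  have hSfin : ∀ m, N (S m) < ∞ := fun m => by
    have := hS 0 m m.zero_le
    simp only [S, Finset.range_zero, Finset.sum_empty, sub_zero, pow_zero] at this
    exact (le_self_add.trans this).trans_lt ENNReal.one_lt_top
  obtain ⟨g, hg, hlim⟩ := hN.complete S hSfin <| by
    intro ε hε
    have hpow : Tendsto (fun n : ℕ => (2⁻¹ : ℝ≥0∞) ^ n) atTop (𝓝 0) :=
      ENNReal.tendsto_pow_atTop_nhds_zero_of_lt_one (by simp)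
    obtain ⟨n₀, hn₀⟩ := (hpow.eventually_lt_const hε).exists
    have h5 : ∀ k m, n₀ ≤ k → k ≤ m → N (S m - S k) < ε := fun k m hk hkm =>
      (le_self_add.trans (hS k m hkm)).trans_lt
        ((pow_le_pow_right_of_le_one' (by simp) hk).trans_lt hn₀)
    refine ⟨n₀, fun m hm n hn => ?_⟩
    rcases le_total m n with h | h
    · rw [hN.sub_comm]
      exact h5 m n hm h
    · exact h5 n m hn h
  -- The partial sums `S m` with `m > n` are at least `v n`, and so is their limit in norm.
  have hvg : ∀ n, ∀ᵐ t : I, |v n t| ≤ |g t| := by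
    intro n
    have h6 : N ((v n - g) ⊔ 0) = 0 := by
      refine nonpos_iff_eq_zero.1 (ge_of_tendsto hlim ?_)
      filter_upwards [eventually_gt_atTop n] with m hm
      refine hN.ideal _ _ ?_
      filter_upwards [ae_all_iff.2 hv, AEEqFun.coeFn_fun_finsetSum (Finset.range m) v,
        AEEqFun.coeFn_sub (S m) g, AEEqFun.coeFn_sub (v n) g, AEEqFun.coeFn_sup (v n - g) 0,
        AEEqFun.coeFn_zero (α := I) (β := ℝ)] with t h7 h8 h9 h10 h11 h12
      have h13 : v n t ≤ S m t := by
        change v n t ≤ (∑ i ∈ Finset.range m, v i) t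
        rw [h8]
        exact Finset.single_le_sum (f := fun i => v i t) (fun i _ => h7 i)
          (Finset.mem_range.2 hm)
      rw [h11, h10, h9, h12]
      simp only [Pi.sub_apply, Pi.zero_apply]
      rw [abs_of_nonneg le_sup_right]
      refine sup_le ((sub_le_sub_right h13 _).trans (le_abs_self _)) (abs_nonneg _)
    have h14 := hN.eq_zero _ h6
    filter_upwards [hv n, AEEqFun.coeFn_sub (v n) g, AEEqFun.coeFn_sup (v n - g) 0,
      AEEqFun.coeFn_zero (α := I) (β := ℝ)] with t h7 h10 h11 h12
    rw [h14, h10, h12] at h11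
    have h15 : v n t - g t ≤ 0 := by
      have := le_sup_left (a := (v n - g : I → ℝ) t) (b := (0 : I → ℝ) t)
      rw [← h11] at this
      exact this
    rw [abs_of_nonneg h7]
    exact (sub_nonpos.1 h15).trans (le_abs_self _)
  obtain ⟨n, hn⟩ := ENNReal.exists_nat_gt (hT g hg).ne
  exact absurd (hn.trans_le ((hvT n).trans (hmono _ _ (hvg n)))) (lt_irrefl _)

theorem exists_forall_le_mul_of_forall_lt_top (hN : IsRINorm N) {T : Fn → ℝ≥0∞}
    (hmono : ∀ x y : Fn, (∀ᵐ t : I, |x t| ≤ |y t|) → T x ≤ T y)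
    (hsmul : ∀ (c : ℝ) x, T (c • x) = ‖c‖ₑ * T x) (hT : ∀ x, N x < ∞ → T x < ∞) :
    ∃ C : ℝ≥0, ∀ x, T x ≤ C * N x := by
  obtain ⟨C, hC⟩ := hN.exists_forall_le_of_forall_lt_top hmono hsmul hT
  refine ⟨C + 1, fun x => ?_⟩
  rcases eq_or_ne (N x) ∞ with htop | htop
  · rw [htop, ENNReal.mul_top (by simp)]
    exact le_top
  rcases eq_or_ne (N x) 0 with h0 | h0
  · have : T 0 = 0 := by simpa using hsmul 0 0
    rw [hN.eq_zero x h0, this]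
    exact zero_le
  obtain ⟨r, hr⟩ : ∃ r : ℝ≥0, (r : ℝ≥0∞) = N x := ⟨_, ENNReal.coe_toNNReal htop⟩
  have hr0 : r ≠ 0 := by rintro rfl; simp at hr; exact h0 hr.symm
  have hr1 : (r : ℝ) ≠ 0 := by exact_mod_cast hr0
  have hre : ‖(r : ℝ)‖ₑ = r := by rw [Real.enorm_of_nonneg r.coe_nonneg]; simp
  have hx : x = (r : ℝ) • ((r : ℝ)⁻¹ • x) := by rw [smul_smul, mul_inv_cancel₀ hr1, one_smul]
  have h1 : N ((r : ℝ)⁻¹ • x) ≤ 1 := by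
    rw [hN.smul, ← hr, enorm_inv hr1, hre, ENNReal.inv_mul_cancel (by simpa using hr0) (by simp)]
  calc T x = r * T ((r : ℝ)⁻¹ • x) := by rw [← hre, ← hsmul, ← hx]
    _ ≤ r * C := by gcongr; exact hC _ h1
    _ ≤ (C + 1 : ℝ≥0) * N x := by
      rw [← hr, mul_comm]
      gcongr
      simp

end IsRINorm

/-! ### The Kruglov operator -/

instance : IsProbabilityMeasure poissonProb := by
  unfold poissonProb
  infer_instance

/-- A measure preserving map from `[0,1]` to the probability space of the Poisson sums. -/
def poissonMap : I → ℕ × (ℕ → I) := (exists_measurePreserving poissonProb).choose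

theorem measurePreserving_poissonMap : MeasurePreserving poissonMap volume poissonProb :=
  (exists_measurePreserving poissonProb).choose_spec

theorem measurable_poissonSum (f : Fn) : Measurable (poissonSum f) := by
  refine measurable_from_prod_countable_right fun n => ?_
  change Measurable fun ω : ℕ → I => ∑ i ∈ Finset.range n, f (ω i)
  exact Finset.measurable_sum _ fun i _ => f.measurable.comp (measurable_pi_apply i)

/-- The Kruglov operator: `π(f)` realized as a function on `[0,1]`. -/
def kruglov (f : Fn) : Fn :=
  AEEqFun.mk (poissonSum f ∘ poissonMap)
    ((measurable_poissonSum f).comp measurePreserving_poissonMap.measurable).aestronglyMeasurable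

theorem coeFn_kruglov (f : Fn) : ∀ᵐ s : I, kruglov f s = poissonSum f (poissonMap s) :=
  AEEqFun.coeFn_mk _ _

theorem ae_poissonMap {P : I → Prop} (h : ∀ᵐ t : I, P t) :
    ∀ᵐ s : I, ∀ i, P ((poissonMap s).2 i) := by
  refine ae_all_iff.2 fun i => ?_
  have h1 : MeasurePreserving (fun p : ℕ × (ℕ → I) => p.2 i) poissonProb volume :=
    (measurePreserving_eval_infinitePi (fun _ : ℕ => (volume : Measure I)) i).comp
      measurePreserving_snd
  exact (h1.comp measurePreserving_poissonMap).quasiMeasurePreserving.ae h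

theorem abs_kruglov_le {f g : Fn} (h : ∀ᵐ t : I, |f t| ≤ g t) :
    ∀ᵐ s : I, |kruglov f s| ≤ kruglov g s := by
  filter_upwards [coeFn_kruglov f, coeFn_kruglov g, ae_poissonMap h] with s h1 h2 h3
  rw [h1, h2]
  exact (Finset.abs_sum_le_sum_abs _ _).trans (Finset.sum_le_sum fun i _ => h3 i)

theorem kruglov_add (f g : Fn) : kruglov (f + g) = kruglov f + kruglov g := by
  refine AEEqFun.ext ?_
  filter_upwards [coeFn_kruglov f, coeFn_kruglov g, coeFn_kruglov (f + g),
    AEEqFun.coeFn_add (kruglov f) (kruglov g), ae_poissonMap (AEEqFun.coeFn_add f g)]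
    with s h1 h2 h3 h4 h5
  rw [h4, Pi.add_apply, h1, h2, h3]
  simp only [poissonSum, h5, Pi.add_apply, Finset.sum_add_distrib]

theorem kruglov_smul (c : ℝ) (f : Fn) : kruglov (c • f) = c • kruglov f := by
  refine AEEqFun.ext ?_
  filter_upwards [coeFn_kruglov f, coeFn_kruglov (c • f), AEEqFun.coeFn_smul c (kruglov f),
    ae_poissonMap (AEEqFun.coeFn_smul c f)] with s h1 h2 h3 h4
  rw [h3, Pi.smul_apply, h1, h2]
  simp only [poissonSum, h4, Pi.smul_apply, smul_eq_mul, Finset.mul_sum]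

theorem coeFn_kruglov_one : ∀ᵐ s : I, kruglov 1 s = (poissonMap s).1 := by
  filter_upwards [coeFn_kruglov 1] with s hs
  rw [hs]
  simp [poissonSum]

theorem volume_lt_abs_kruglov (f : Fn) (τ : ℝ) :
    volume {s : I | τ < |kruglov f s|} = poissonProb {p | τ < |poissonSum f p|} := by
  rw [← measurePreserving_poissonMap.measure_preimage
    (measurableSet_lt measurable_const (measurable_poissonSum f).abs).nullMeasurableSet]
  refine measure_congr ?_
  filter_upwards [coeFn_kruglov f] with s hs
  refine propext ?_
  change τ < |kruglov f s| ↔ τ < |poissonSum f (poissonMap s)|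
  rw [hs]

theorem hasRandomVariable_poissonSum_iff (E : RISpace) (f : Fn) :
    E.HasRandomVariable poissonProb (poissonSum f) ↔ E.enorm (kruglov f) < ∞ := by
  constructor
  · rintro ⟨g, hg, hid⟩
    rw [← E.symmetric g (kruglov f)]
    · exact hg
    · intro τ _
      rw [volume_lt_abs_kruglov]
      exact hid.measure_mem_eq (s := {r : ℝ | τ < |r|})
        (measurableSet_lt measurable_const measurable_id.abs)
  · intro h
    refine ⟨kruglov f, h, (kruglov f).aemeasurable, (measurable_poissonSum f).aemeasurable, ?_⟩
    rw [Measure.map_congr (coeFn_kruglov f), ← measurePreserving_poissonMap.map_eq,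
      Measure.map_map (measurable_poissonSum f) measurePreserving_poissonMap.measurable]
    rfl

theorem poissonMeasure_one_singleton (k : ℕ) :
    poissonMeasure 1 {k} = ENNReal.ofReal (Real.exp (-1) / k.factorial) := by
  rw [poissonMeasure_singleton]
  simp

/-- The probability that there are `k` summands, all of them evaluated at points of `A`. -/
theorem poissonProb_all_mem (k : ℕ) {A : Set I} (hA : MeasurableSet A) :
    poissonProb {p | p.1 = k ∧ ∀ i < k, p.2 i ∈ A} =
      ENNReal.ofReal (Real.exp (-1) / k.factorial) * volume A ^ k := by
  have h : {p : ℕ × (ℕ → I) | p.1 = k ∧ ∀ i < k, p.2 i ∈ A} =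
      {k} ×ˢ Set.pi (Finset.range k : Set ℕ) (fun _ => A) := by
    ext p
    simp [Set.mem_pi]
  rw [h, poissonProb, Measure.prod_prod, poissonMeasure_one_singleton,
    Measure.infinitePi_pi _ (fun _ _ => hA)]
  simp

theorem poissonProb_le_count (n : ℕ) :
    poissonProb {p | n ≤ p.1} ≤ ENNReal.ofReal (1 / n.factorial) := by
  have h : {p : ℕ × (ℕ → I) | n ≤ p.1} = (⋃ j : ℕ, {n + j}) ×ˢ Set.univ := by
    ext p
    simp only [Set.mem_ofPred_eq, Set.mem_prod, Set.mem_iUnion, Set.mem_singleton_iff,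
      Set.mem_univ, and_true]
    exact ⟨fun h => ⟨p.1 - n, by omega⟩, fun ⟨j, hj⟩ => by omega⟩
  rw [h, poissonProb, Measure.prod_prod, measure_univ, mul_one]
  calc poissonMeasure 1 (⋃ j : ℕ, {n + j}) ≤ ∑' j, poissonMeasure 1 {n + j} :=
        measure_iUnion_le _
    _ ≤ ∑' j, ENNReal.ofReal (1 / n.factorial) * poissonMeasure 1 {j} := by
        refine ENNReal.tsum_le_tsum fun j => ?_
        rw [poissonMeasure_one_singleton, poissonMeasure_one_singleton,
          ← ENNReal.ofReal_mul (by positivity)]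
        refine ENNReal.ofReal_le_ofReal ?_
        rw [div_mul_div_comm, one_mul]
        gcongr
        exact_mod_cast Nat.le_of_dvd (Nat.factorial_pos _)
          (Nat.factorial_mul_factorial_dvd_factorial_add n j)
    _ = ENNReal.ofReal (1 / n.factorial) * poissonMeasure 1 Set.univ := by
        rw [ENNReal.tsum_mul_left, ← measure_iUnion (fun i j hij => by simpa using hij)
          (fun _ => measurableSet_singleton _), Set.iUnion_of_singleton]
    _ = ENNReal.ofReal (1 / n.factorial) := by rw [measure_univ, mul_one]

/-- If there is just one summand, `π(f)` is a copy of `f`. -/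
theorem IsRINorm.le_three_mul_kruglov {N : Fn → ℝ≥0∞} (hN : IsRINorm N) (f : Fn) :
    N f ≤ 3 * N (kruglov f) := by
  refine hN.le_mul_of_volume_le (M := 3) (by norm_num) fun τ _ => ?_
  rw [volume_lt_abs_kruglov]
  have h := poissonProb_all_mem 1 (measurableSet_lt_abs f τ)
  have hsub : poissonProb {p | p.1 = 1 ∧ ∀ i < 1, p.2 i ∈ {t : I | τ < |f t|}} ≤
      poissonProb {p | τ < |poissonSum f p|} := by
    refine measure_mono fun p hp => ?_
    have h0 : τ < |f (p.2 0)| := hp.2 0 one_pos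
    change τ < |poissonSum f p|
    rwa [poissonSum, hp.1, Finset.sum_range_one]
  rw [h] at hsub
  have he : (1 : ℝ) ≤ 3 * Real.exp (-1) := by
    rw [Real.exp_neg, ← div_eq_mul_inv, le_div_iff₀ (Real.exp_pos 1), one_mul]
    exact Real.exp_one_lt_three.le
  calc volume {s : I | τ < |f s|} = ENNReal.ofReal 1 * volume {s : I | τ < |f s|} := by simp
    _ ≤ ENNReal.ofReal (3 * Real.exp (-1)) * volume {s : I | τ < |f s|} := by gcongr
    _ = 3 * (ENNReal.ofReal (Real.exp (-1)) * volume {s : I | τ < |f s|}) := by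
      rw [ENNReal.ofReal_mul (by norm_num), mul_assoc]
      simp
    _ ≤ (3 : ℕ) * poissonProb {p | τ < |poissonSum f p|} := by
      push_cast
      gcongr
      simpa using hsub

/-- Only one implication of the Kruglov property is a condition on `E`; the other one always
holds. -/
theorem hasKruglov_iff (E : RISpace) :
    E.HasKruglov ↔ ∀ f, E.enorm f < ∞ → E.enorm (kruglov f) < ∞ := by
  constructor
  · intro h f hf
    exact (hasRandomVariable_poissonSum_iff E f).1 ((h f).1 hf)
  · refine fun h f => ⟨fun hf => (hasRandomVariable_poissonSum_iff E f).2 (h f hf), fun hf => ?_⟩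
    have h1 := (hasRandomVariable_poissonSum_iff E f).1 hf
    exact (E.isRINorm.le_three_mul_kruglov f).trans_lt (ENNReal.mul_lt_top (by simp) h1)

/-! ### Boundedness of the Kruglov operator and its consequences -/

/-- The Kruglov operator is bounded with respect to `N`. -/
def KruglovBounded (N : Fn → ℝ≥0∞) : Prop := ∃ C : ℝ≥0, ∀ f, N (kruglov f) ≤ C * N f

theorem abs_tail_zero_le {x y : Fn} (h : ∀ᵐ t : I, |x t| ≤ |y t|) :
    ∀ᵐ t : I, |tail 0 x t| ≤ tail 0 y t := by
  filter_upwards [h, coeFn_tail_zero x, coeFn_tail_zero y] with t h1 h2 h3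
  rwa [h2, h3, abs_abs]

theorem tail_zero_smul (c : ℝ) (x : Fn) : tail 0 (c • x) = |c| • tail 0 x := by
  refine AEEqFun.ext ?_
  filter_upwards [coeFn_tail_zero x, coeFn_tail_zero (c • x), AEEqFun.coeFn_smul c x,
    AEEqFun.coeFn_smul |c| (tail 0 x)] with t h1 h2 h3 h4
  rw [h2, h4, h3, Pi.smul_apply, Pi.smul_apply, h1, smul_eq_mul, smul_eq_mul, abs_mul]

/-- The functional `x ↦ N (π(|x|))` is monotone and homogeneous, so that the gliding hump argument
applies to it. -/
theorem kruglovBounded_of_forall_lt_top {N : Fn → ℝ≥0∞} (hN : IsRINorm N)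
    (h : ∀ f, N f < ∞ → N (kruglov f) < ∞) : KruglovBounded N := by
  obtain ⟨C, hC⟩ := hN.exists_forall_le_mul_of_forall_lt_top
    (T := fun x => N (kruglov (tail 0 x)))
    (fun x y hxy => hN.ideal _ _ <| by
      filter_upwards [abs_kruglov_le (abs_tail_zero_le hxy)] with s hs
        using hs.trans (le_abs_self _))
    (fun c x => by
      simp only [tail_zero_smul, kruglov_smul, hN.smul, ← Real.norm_eq_abs, enorm_norm])
    (fun x hx => h _ (by rwa [hN.tail_zero]))
  refine ⟨C, fun f => le_trans (hN.ideal _ _ ?_) (hC f)⟩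
  have : ∀ᵐ t : I, |f t| ≤ tail 0 f t := by
    filter_upwards [coeFn_tail_zero f] with t ht using ht.ge
  filter_upwards [abs_kruglov_le this] with s hs using hs.trans (le_abs_self _)

/-- Splitting `|f|` at the level `a`, the Poisson sum is at most the Poisson sum of the tail plus
`a` times the number of summands. -/
theorem abs_kruglov_le_tail_add (a : ℝ) (f : Fn) :
    ∀ᵐ s : I, |kruglov f s| ≤ kruglov (tail a f) s + a * kruglov 1 s := by
  have h : ∀ᵐ t : I, |f t| ≤ (tail a f + a • (1 : Fn)) t := by
    filter_upwards [coeFn_tail a f, AEEqFun.coeFn_add (tail a f) (a • (1 : Fn)),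
      AEEqFun.coeFn_smul a (1 : Fn)] with t h1 h2 h3
    rw [h2, Pi.add_apply, h3, h1]
    simp only [Pi.smul_apply, AEEqFun.coeFn_one_eq, smul_eq_mul, mul_one]
    linarith [le_max_left (|f t| - a) 0]
  filter_upwards [abs_kruglov_le h, AEEqFun.coeFn_add (kruglov (tail a f)) (kruglov (a • 1)),
    AEEqFun.coeFn_smul a (kruglov 1)] with s h1 h2 h3
  rw [kruglov_add, h2, Pi.add_apply, kruglov_smul, h3] at h1
  exact h1

theorem volume_le_count (n : ℕ) :
    volume {s : I | n ≤ (poissonMap s).1} = poissonProb {p | n ≤ p.1} :=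
  measurePreserving_poissonMap.measure_preimage
    (measurableSet_le measurable_const measurable_fst).nullMeasurableSet

theorem volume_le_count_pos (n : ℕ) : 0 < volume {s : I | n ≤ (poissonMap s).1} := by
  rw [volume_le_count]
  have h := poissonProb_all_mem n MeasurableSet.univ
  rw [measure_univ, one_pow, mul_one] at h
  have h1 : (0 : ℝ≥0∞) < ENNReal.ofReal (Real.exp (-1) / n.factorial) :=
    ENNReal.ofReal_pos.2 (by positivity)
  rw [← h] at h1
  exact h1.trans_le (measure_mono fun p hp => hp.1.ge)

namespace IsRINorm

variable {N : Fn → ℝ≥0∞}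

theorem lt_top_kruglov_one (hN : IsRINorm N) (hK : KruglovBounded N) : N (kruglov 1) < ∞ := by
  obtain ⟨C, hC⟩ := hK
  exact (hC 1).trans_lt (ENNReal.mul_lt_top (by simp) hN.one_lt_top)

/-- The number of summands is an unbounded element of the space, which forces the norms of
functions bounded by `1` to vanish with their support. -/
theorem supportContinuous (hN : IsRINorm N) (hK : KruglovBounded N) : SupportContinuous N := by
  intro ε hε
  obtain ⟨δ, hδ, hδε⟩ := ENNReal.exists_nnreal_pos_mul_lt (hN.lt_top_kruglov_one hK).ne hε.ne'
  obtain ⟨k, hk⟩ := exists_nat_gt (δ : ℝ)⁻¹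
  have hδ0 : (0 : ℝ) < δ := by exact_mod_cast hδ
  refine ⟨_, volume_le_count_pos k, fun x hx hv => ?_⟩
  calc N x ≤ N ((δ : ℝ) • kruglov 1) := by
        refine hN.mono_of_volume_le fun τ hτ => ?_
        rcases lt_or_ge τ 1 with h1 | h1
        · calc volume {s : I | τ < |x s|} ≤ volume {s : I | 0 < |x s|} :=
                measure_mono fun s (hs : τ < |x s|) => hτ.trans hs
            _ ≤ volume {s : I | k ≤ (poissonMap s).1} := hv.le
            _ ≤ _ := by
              refine measure_mono_ae (μ := (volume : Measure I)) ?_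
              filter_upwards [coeFn_kruglov_one, AEEqFun.coeFn_smul (δ : ℝ) (kruglov 1)]
                with s h2 h3
              intro (h4 : k ≤ (poissonMap s).1)
              change τ < |((δ : ℝ) • kruglov 1 : Fn) s|
              rw [h3, Pi.smul_apply, h2, smul_eq_mul, abs_of_nonneg (by positivity)]
              have h5 : (k : ℝ) ≤ (poissonMap s).1 := by exact_mod_cast h4
              refine h1.trans ?_
              rw [← mul_inv_cancel₀ hδ0.ne']
              gcongr
              exact hk.trans_le h5
        · refine le_of_eq_of_le ?_ zero_le
          have : ∀ᵐ s : I, ¬ τ < |x s| := by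
            filter_upwards [hx] with s hs using (hs.trans h1).not_gt
          simpa [ae_iff] using this
    _ = δ * N (kruglov 1) := by
        rw [hN.smul, Real.enorm_of_nonneg hδ0.le]
        simp
    _ < ε := hδε

end IsRINorm

/-- The indicator function of a measurable set, as a class of functions. -/
def indicatorFn {A : Set I} (hA : MeasurableSet A) : Fn :=
  AEEqFun.mk (A.indicator fun _ => (1 : ℝ)) (measurable_const.indicator hA).aestronglyMeasurable

theorem coeFn_indicatorFn {A : Set I} (hA : MeasurableSet A) :
    ∀ᵐ t : I, indicatorFn hA t = A.indicator (fun _ => (1 : ℝ)) t :=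
  AEEqFun.coeFn_mk _ _

theorem SupportContinuous.exists_indicatorFn_lt {N : Fn → ℝ≥0∞} (hc : SupportContinuous N)
    {ε : ℝ≥0∞} (hε : 0 < ε) :
    ∃ (A : Set I) (hA : MeasurableSet A), 0 < volume A ∧ N (indicatorFn hA) < ε := by
  obtain ⟨δ, hδ, h⟩ := hc ε hε
  obtain ⟨r, hr, hrδ⟩ := ENNReal.lt_iff_exists_nnreal_btwn.1 (lt_min hδ one_pos)
  have hr1 : r ≤ 1 := by exact_mod_cast (hrδ.trans_le (min_le_right _ _)).le
  have hA : MeasurableSet {t : I | ENNReal.ofReal t < r} :=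
    measurableSet_lt (by fun_prop) measurable_const
  have hvA : volume {t : I | ENNReal.ofReal t < r} = r := volume_ofReal_lt (by exact_mod_cast hr1)
  refine ⟨_, hA, hr.trans_eq hvA.symm, h _ ?_ ?_⟩
  · filter_upwards [coeFn_indicatorFn hA] with t ht
    rw [ht]
    rw [abs_of_nonneg (Set.indicator_nonneg (fun _ _ => zero_le_one) t)]
    exact Set.indicator_le_self' (fun _ _ => zero_le_one) t
  · refine lt_of_le_of_lt ?_ (hrδ.trans_le (min_le_left _ _))
    refine le_of_le_of_eq ?_ hvA
    refine measure_mono_ae (μ := (volume : Measure I)) ?_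
    filter_upwards [coeFn_indicatorFn hA] with t ht
    intro (h1 : 0 < |indicatorFn hA t|)
    rw [ht] at h1
    change t ∈ {t : I | ENNReal.ofReal t < r}
    exact Set.mem_of_indicator_ne_zero (abs_pos.1 h1)

theorem four_mul_factorial_mul_pow_le {a : ℝ} (ha : 0 ≤ a) {m : ℕ} (hm : 2 ≤ m)
    (ham : 1 ≤ a * (m + 1)) {k : ℕ} (hk : 1 ≤ k) :
    4 * (k.factorial : ℝ) ≤ a ^ k * (2 * k + m).factorial := by
  have h1 : 4 * k.factorial ≤ (k + m).factorial := by
    calc 4 * k.factorial = k.factorial * 2 ^ 2 := by ring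
      _ ≤ k.factorial * (k + 1) ^ m := Nat.mul_le_mul_left _
        ((Nat.pow_le_pow_right two_pos hm).trans (Nat.pow_le_pow_left (by omega) m))
      _ ≤ (k + m).factorial := Nat.factorial_mul_pow_le_factorial
  have h2 : 4 * k.factorial * (m + 1) ^ k ≤ (2 * k + m).factorial := by
    calc 4 * k.factorial * (m + 1) ^ k ≤ (k + m).factorial * (k + m + 1) ^ k := by
          gcongr
          omega
      _ ≤ (k + m + k).factorial := Nat.factorial_mul_pow_le_factorial
      _ = (2 * k + m).factorial := by congr 1; ring
  have h3 : (4 * k.factorial * (m + 1) ^ k : ℝ) ≤ (2 * k + m).factorial := by exact_mod_cast h2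
  calc 4 * (k.factorial : ℝ) ≤ 4 * k.factorial * (a * (m + 1)) ^ k :=
        le_mul_of_one_le_right (by positivity) (one_le_pow₀ ham)
    _ = a ^ k * (4 * k.factorial * (m + 1) ^ k) := by rw [mul_pow]; ring
    _ ≤ a ^ k * (2 * k + m).factorial := by gcongr

/-- The number of summands has much lighter tails than twice the number of summands at points of
`A`, however small the measure `a` of `A` is: it is at least `2 k + m` with probability at most
`1 / (2 k + m)!`, while there are `k` summands, all at points of `A`, with probability
`a ^ k / (e k!)`. -/
theorem poissonProb_le_count_le {A : Set I} (hA : MeasurableSet A) {m : ℕ} (hm : 2 ≤ m)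
    (ham : 1 ≤ (volume A).toReal * (m + 1)) {k : ℕ} (hk : 1 ≤ k) :
    poissonProb {p | 2 * k + m ≤ p.1} ≤ poissonProb {p | p.1 = k ∧ ∀ i < k, p.2 i ∈ A} := by
  refine (poissonProb_le_count _).trans ?_
  have hvol : volume A = ENNReal.ofReal (volume A).toReal :=
    (ENNReal.ofReal_toReal (measure_ne_top _ _)).symm
  rw [poissonProb_all_mem k hA, hvol, ← ENNReal.ofReal_pow ENNReal.toReal_nonneg,
    ← ENNReal.ofReal_mul (by positivity)]
  refine ENNReal.ofReal_le_ofReal ?_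
  set a := (volume A).toReal
  have h := four_mul_factorial_mul_pow_le (a := a) ENNReal.toReal_nonneg hm ham hk
  have he : (1 : ℝ) ≤ 4 * Real.exp (-1) := by
    rw [Real.exp_neg, ← div_eq_mul_inv, le_div_iff₀ (Real.exp_pos 1), one_mul]
    linarith [Real.exp_one_lt_three]
  rw [div_mul_eq_mul_div, div_le_div_iff₀ (by positivity) (by positivity), one_mul]
  calc (k.factorial : ℝ) ≤ 4 * Real.exp (-1) * k.factorial :=
        le_mul_of_one_le_left (by positivity) he
    _ = Real.exp (-1) * (4 * k.factorial) := by ring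
    _ ≤ Real.exp (-1) * (a ^ k * (2 * k + m).factorial) := by gcongr
    _ = _ := by ring

/-- The number of summands belongs to the closure of `L_∞`: its tails are dominated by twice the
image under the Kruglov operator of the indicator of a set of small measure. -/
theorem IsRINorm.tailsVanish_kruglov_one {N : Fn → ℝ≥0∞} (hN : IsRINorm N)
    (hK : KruglovBounded N) : TailsVanish N (kruglov 1) := by
  intro ε hε
  obtain ⟨C, hC⟩ := id hK
  obtain ⟨ρ, hρ, hρε⟩ := ENNReal.exists_nnreal_pos_mul_lt
    (a := 2 * C) (by finiteness) hε.ne'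
  obtain ⟨A, hA, hA0, hχN⟩ := (hN.supportContinuous hK).exists_indicatorFn_lt
    (show (0 : ℝ≥0∞) < ρ by exact_mod_cast hρ)
  set χ := indicatorFn hA
  have hr0 : 0 < (volume A).toReal := ENNReal.toReal_pos hA0.ne' (measure_ne_top _ _)
  obtain ⟨m, hm⟩ := exists_nat_ge (volume A).toReal⁻¹
  have ham : 1 ≤ (volume A).toReal * ((m + 2 : ℕ) + 1) := by
    calc (1 : ℝ) = (volume A).toReal * (volume A).toReal⁻¹ := (mul_inv_cancel₀ hr0.ne').symm
      _ ≤ (volume A).toReal * ((m + 2 : ℕ) + 1) := by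
        gcongr
        push_cast
        linarith
  refine ⟨m + 4, lt_of_le_of_lt ?_ hρε⟩
  calc N (tail (m + 4 : ℕ) (kruglov 1)) ≤ N ((2 : ℝ) • kruglov χ) := by
        refine hN.mono_of_volume_le fun τ hτ => ?_
        -- `k` is the least integer with `τ < 2 * k`.
        let k : ℕ := ⌊τ / 2⌋₊ + 1
        have hk1 : τ < 2 * k := by
          have := Nat.lt_floor_add_one (τ / 2)
          push_cast [k]
          linarith
        have hk2 : 2 * (k : ℝ) ≤ τ + 2 := by
          have := Nat.floor_le (show 0 ≤ τ / 2 by positivity)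
          push_cast [k]
          linarith
        calc volume {s : I | τ < |tail (m + 4 : ℕ) (kruglov 1) s|}
            ≤ volume {s : I | 2 * k + (m + 2) ≤ (poissonMap s).1} := by
              refine measure_mono_ae (μ := (volume : Measure I)) ?_
              filter_upwards [coeFn_kruglov_one, abs_tail (m + 4 : ℕ) (kruglov 1)] with s h1 h2
              intro (h3 : τ < |tail (m + 4 : ℕ) (kruglov 1) s|)
              rw [h2, h1, lt_max_iff, or_iff_left hτ.not_gt, Nat.abs_cast] at h3
              change 2 * k + (m + 2) ≤ (poissonMap s).1
              have h4 : ((2 * k + (m + 2) : ℕ) : ℝ) ≤ (poissonMap s).1 := by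
                push_cast at h3 ⊢
                linarith
              exact_mod_cast h4
          _ = poissonProb {p | 2 * k + (m + 2) ≤ p.1} := volume_le_count _
          _ ≤ poissonProb {p | p.1 = k ∧ ∀ i < k, p.2 i ∈ A} :=
              poissonProb_le_count_le hA (by omega) ham (by omega)
          _ = volume {s : I | (poissonMap s).1 = k ∧ ∀ i < k, (poissonMap s).2 i ∈ A} := by
              refine (measurePreserving_poissonMap.measure_preimage
                (MeasurableSet.nullMeasurableSet ?_)).symm
              have hm1 : MeasurableSet {p : ℕ × (ℕ → I) | p.1 = k} :=
                measurable_fst (measurableSet_singleton k)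
              have hm2 : ∀ i, MeasurableSet {p : ℕ × (ℕ → I) | i < k → p.2 i ∈ A} := fun i =>
                (MeasurableSet.const (i < k)).imp
                  (((measurable_pi_apply i).comp measurable_snd) hA)
              simpa only [Set.ofPred_and, Set.ofPred_forall] using hm1.inter (.iInter hm2)
          _ ≤ volume {s : I | τ < |((2 : ℝ) • kruglov χ : Fn) s|} := by
              refine measure_mono_ae (μ := (volume : Measure I)) ?_
              filter_upwards [coeFn_kruglov χ, ae_poissonMap (coeFn_indicatorFn hA),
                AEEqFun.coeFn_smul (2 : ℝ) (kruglov χ)] with s h1 h2 h3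
              intro (h4 : (poissonMap s).1 = k ∧ ∀ i < k, (poissonMap s).2 i ∈ A)
              have h5 : poissonSum χ (poissonMap s) = k := by
                rw [poissonSum, h4.1, Finset.sum_congr rfl (g := fun _ => (1 : ℝ))]
                · simp
                · intro i hi
                  rw [h2, Set.indicator_of_mem (h4.2 i (Finset.mem_range.1 hi))]
              change τ < |((2 : ℝ) • kruglov χ : Fn) s|
              rw [h3, Pi.smul_apply, h1, h5, smul_eq_mul, abs_of_nonneg (by positivity)]
              exact hk1
    _ = 2 * N (kruglov χ) := by
        rw [hN.smul, Real.enorm_of_nonneg (by norm_num)]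
        simp
    _ ≤ 2 * (C * ρ) := by
        gcongr
        exact (hC χ).trans (by gcongr)
    _ = ρ * (2 * C) := by ring

/-! ### A smaller space with the Kruglov property -/

/-- The set of functions whose tails at the levels `n 0, n 1, …` have norms at most
`1, 1 / 2, 1 / 4, …`. -/
def tailBall (N : Fn → ℝ≥0∞) (n : ℕ → ℕ) : Set Fn := {x | ∀ j, N (tail (n j) x) ≤ 2⁻¹ ^ j}

namespace IsRINorm

variable {N : Fn → ℝ≥0∞}

theorem isUnitBall_tailBall (hN : IsRINorm N) {n : ℕ → ℕ} (h0 : n 0 = 0) (hn : ∀ j, j ≤ n j) :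
    IsUnitBall N (tailBall N n) where
  convex x hx y hy a b ha hb hab j := by
    calc N (tail (n j) (a • x + b • y)) ≤ N (a • tail (n j) x) + N (b • tail (n j) y) := by
          refine hN.le_add_of_abs_le ?_
          filter_upwards [abs_tail (n j) x, abs_tail (n j) y, abs_tail (n j) (a • x + b • y),
            AEEqFun.coeFn_add (a • x) (b • y), AEEqFun.coeFn_smul a x, AEEqFun.coeFn_smul b y,
            AEEqFun.coeFn_smul a (tail (n j) x), AEEqFun.coeFn_smul b (tail (n j) y)]
            with t h1 h2 h3 h4 h5 h6 h7 h8
          rw [h3, h4, Pi.add_apply, h5, h6, h7, h8]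
          simp only [Pi.smul_apply, smul_eq_mul]
          rw [abs_mul, abs_mul, h1, h2, abs_of_nonneg ha, abs_of_nonneg hb]
          refine max_le ?_ (by positivity)
          have h9 := abs_add_le (a * x t) (b * y t)
          rw [abs_mul, abs_mul, abs_of_nonneg ha, abs_of_nonneg hb] at h9
          have h10 := mul_le_mul_of_nonneg_left (le_max_left (|x t| - n j) 0) ha
          have h11 := mul_le_mul_of_nonneg_left (le_max_left (|y t| - n j) 0) hb
          have h12 : (n j : ℝ) = a * n j + b * n j := by rw [← add_mul, hab, one_mul]
          linarith
      _ ≤ ENNReal.ofReal a * 2⁻¹ ^ j + ENNReal.ofReal b * 2⁻¹ ^ j := by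
          rw [hN.smul, hN.smul, Real.enorm_of_nonneg ha, Real.enorm_of_nonneg hb]
          gcongr
          · exact hx j
          · exact hy j
      _ = 2⁻¹ ^ j := by
          rw [← add_mul, ← ENNReal.ofReal_add ha hb, hab, ENNReal.ofReal_one, one_mul]
  solid x y h hy j := (hN.tail_le_tail le_rfl h).trans (hy j)
  symmetric x y h hy j := by
    rw [hN.symmetric _ _ (h.tail (n j).cast_nonneg)]
    exact hy j
  absorbs_one := by
    obtain ⟨c, hc, h⟩ := ENNReal.exists_nnreal_pos_mul_lt hN.one_lt_top.ne one_ne_zero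
    have hd : 0 < min c 1 := lt_min hc one_pos
    have hd0 : (0 : ℝ) < (min c 1 : ℝ≥0) := by exact_mod_cast hd
    have hd1 : ((min c 1 : ℝ≥0) : ℝ) ≤ 1 := by exact_mod_cast min_le_right c 1
    refine ⟨(min c 1 : ℝ≥0), hd0, fun j => ?_⟩
    rcases Nat.eq_zero_or_pos j with rfl | hj
    · rw [h0, Nat.cast_zero, hN.tail_zero, hN.smul, Real.enorm_of_nonneg hd0.le,
        ENNReal.ofReal_coe_nnreal, pow_zero]
      refine le_trans ?_ h.le
      gcongr
      exact min_le_left c 1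
    · refine le_of_eq_of_le (b := N 0) ?_ (by simp [hN.map_zero])
      congr 1
      refine AEEqFun.ext ?_
      filter_upwards [coeFn_tail (n j) (((min c 1 : ℝ≥0) : ℝ) • (1 : Fn)),
        AEEqFun.coeFn_smul ((min c 1 : ℝ≥0) : ℝ) (1 : Fn),
        AEEqFun.coeFn_zero (α := I) (β := ℝ)] with t h1 h2 h3
      rw [h1, h2, h3]
      simp only [Pi.smul_apply, AEEqFun.coeFn_one_eq, smul_eq_mul, mul_one, abs_of_pos hd0,
        Pi.zero_apply]
      refine max_eq_right (sub_nonpos.2 (hd1.trans ?_))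
      exact_mod_cast Nat.one_le_iff_ne_zero.2 (hj.trans_le (hn j)).ne'
  le_one x hx := by
    have := hx 0
    rwa [h0, Nat.cast_zero, hN.tail_zero, pow_zero] at this
  closed v x hv hlim j := by
    have h1 : ∀ m, N (tail (n j) x) ≤ 2⁻¹ ^ j + N (v m - x) := by
      intro m
      refine (hN.le_add_of_abs_le (x := tail (n j) (v m)) (y := v m - x) ?_).trans
        (by gcongr; exact hv m j)
      filter_upwards [abs_tail (n j) x, abs_tail (n j) (v m), AEEqFun.coeFn_sub (v m) x]
        with t h1 h2 h3
      rw [h1, h2, h3, Pi.sub_apply]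
      refine max_le ?_ (by positivity)
      have h4 := abs_sub_abs_le_abs_sub (x t) (v m t)
      rw [abs_sub_comm] at h4
      linarith [le_max_left (|v m t| - n j) 0]
    have h2 := hlim.const_add (2⁻¹ ^ j : ℝ≥0∞)
    rw [add_zero] at h2
    exact ge_of_tendsto' h2 h1

/-- There are levels which grow so fast that the functions `n j * π(1)` are small above the level
`n (j + 1)`. -/
theorem exists_levels (hN : IsRINorm N) (h : TailsVanish N (kruglov 1)) :
    ∃ n : ℕ → ℕ, n 0 = 0 ∧ (∀ j, j ≤ n j) ∧
      ∀ j, N (tail (n (j + 1)) ((n j : ℝ) • kruglov 1)) ≤ 2⁻¹ ^ (j + 1) := by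
  have h1 : ∀ j k : ℕ, ∃ m : ℕ, k + 1 ≤ m ∧
      N (tail m ((k : ℝ) • kruglov 1)) ≤ 2⁻¹ ^ (j + 1) := by
    intro j k
    obtain ⟨m, hm⟩ := hN.exists_tail_lt (hN.tailsVanish_smul (k : ℝ) h)
      (ε := 2⁻¹ ^ (j + 1)) (by simp [ENNReal.pow_pos])
    exact ⟨m + (k + 1), by omega, (hm _ (by push_cast; linarith [k.cast_nonneg (α := ℝ)])).le⟩
  choose f hf1 hf2 using h1
  let n : ℕ → ℕ := fun j => Nat.rec 0 (fun j k => f j k) j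
  have hs : ∀ j, n (j + 1) = f j (n j) := fun _ => rfl
  refine ⟨n, rfl, fun j => ?_, fun j => ?_⟩
  · induction j with
    | zero => exact Nat.zero_le _
    | succ j ih =>
      rw [hs]
      exact (Nat.succ_le_succ ih).trans (hf1 _ _)
  · rw [hs]
    exact hf2 _ _

/-- The Kruglov operator shifts the levels by one: the tail of `π(x)` at the level `n (j + 1)` is
controlled by that of `x` at the level `n j`. -/
theorem smul_kruglov_mem_tailBall (hN : IsRINorm N) {C : ℝ≥0}
    (hC : ∀ f, N (kruglov f) ≤ C * N f) {n : ℕ → ℕ} (h0 : n 0 = 0)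
    (hn : ∀ j, N (tail (n (j + 1)) ((n j : ℝ) • kruglov 1)) ≤ 2⁻¹ ^ (j + 1))
    {x : Fn} (hx : x ∈ tailBall N n) :
    ((2 * C + 1 : ℝ≥0) : ℝ)⁻¹ • kruglov x ∈ tailBall N n := by
  set D : ℝ≥0 := 2 * C + 1 with hD
  have hD1 : 1 ≤ D := by simp [hD]
  have hD1' : (1 : ℝ) ≤ D := by exact_mod_cast hD1
  have hD0 : D ≠ 0 := (one_pos.trans_le hD1).ne'
  have hDe : ‖((D : ℝ)⁻¹)‖ₑ = (D : ℝ≥0∞)⁻¹ := by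
    rw [enorm_inv (by exact_mod_cast hD0), Real.enorm_of_nonneg D.coe_nonneg,
      ENNReal.ofReal_coe_nnreal]
  have hDc : (D : ℝ≥0∞)⁻¹ * D = 1 := ENNReal.inv_mul_cancel (by simpa using hD0) (by simp)
  intro j
  rcases j with _ | j
  · have hx0 := hx 0
    rw [h0, Nat.cast_zero, hN.tail_zero] at hx0 ⊢
    rw [pow_zero] at hx0 ⊢
    rw [hN.smul, hDe]
    calc (D : ℝ≥0∞)⁻¹ * N (kruglov x) ≤ (D : ℝ≥0∞)⁻¹ * D := by
          gcongr
          refine (hC x).trans ?_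
          calc C * N x ≤ C * 1 := by gcongr
            _ ≤ D := by
              rw [mul_one, ENNReal.coe_le_coe, hD, two_mul, add_assoc]
              exact le_self_add
      _ = 1 := hDc
  · calc N (tail (n (j + 1)) ((D : ℝ)⁻¹ • kruglov x))
        ≤ N ((D : ℝ)⁻¹ • kruglov (tail (n j) x)) +
            N ((D : ℝ)⁻¹ • tail (n (j + 1)) ((n j : ℝ) • kruglov 1)) := by
          refine hN.le_add_of_abs_le ?_
          filter_upwards [abs_kruglov_le_tail_add (n j) x,
            abs_tail (n (j + 1)) ((D : ℝ)⁻¹ • kruglov x),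
            abs_tail (n (j + 1)) ((n j : ℝ) • kruglov 1),
            AEEqFun.coeFn_smul (D : ℝ)⁻¹ (kruglov x),
            AEEqFun.coeFn_smul (D : ℝ)⁻¹ (kruglov (tail (n j) x)),
            AEEqFun.coeFn_smul (D : ℝ)⁻¹ (tail (n (j + 1)) ((n j : ℝ) • kruglov 1)),
            AEEqFun.coeFn_smul (n j : ℝ) (kruglov 1)] with s h1 h2 h3 h4 h5 h6 h7
          have hDinv : (0 : ℝ) ≤ (D : ℝ)⁻¹ := by positivity
          have hDinv1 : (D : ℝ)⁻¹ ≤ 1 := inv_le_one_of_one_le₀ hD1'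
          rw [h2, h4, h5, h6]
          simp only [Pi.smul_apply, smul_eq_mul, abs_mul, abs_of_nonneg hDinv]
          rw [h3, h7, Pi.smul_apply, smul_eq_mul]
          refine max_le ?_ (by positivity)
          have h8 : (D : ℝ)⁻¹ * n (j + 1) ≤ n (j + 1) :=
            mul_le_of_le_one_left (Nat.cast_nonneg _) hDinv1
          have h9 := mul_le_mul_of_nonneg_left h1 hDinv
          have h10 := mul_le_mul_of_nonneg_left (le_abs_self (kruglov (tail (n j) x) s)) hDinv
          have h11 := mul_le_mul_of_nonneg_left
            (le_max_left (|n j * kruglov 1 s| - n (j + 1)) 0) hDinv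
          have h12 := mul_le_mul_of_nonneg_left (le_abs_self (n j * kruglov 1 s)) hDinv
          linarith
      _ ≤ (D : ℝ≥0∞)⁻¹ * (C * 2⁻¹ ^ j) + (D : ℝ≥0∞)⁻¹ * 2⁻¹ ^ (j + 1) := by
          rw [hN.smul, hN.smul, hDe]
          gcongr
          · exact (hC _).trans (by gcongr; exact hx j)
          · exact hn j
      _ = (D : ℝ≥0∞)⁻¹ * D * 2⁻¹ ^ (j + 1) := by
          have h2 : (2⁻¹ : ℝ≥0∞) ^ j = 2 * 2⁻¹ ^ (j + 1) := by
            rw [pow_succ, mul_comm, mul_assoc,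
              ENNReal.inv_mul_cancel two_ne_zero ENNReal.ofNat_ne_top, mul_one]
          rw [h2, hD]
          push_cast
          ring
      _ = 2⁻¹ ^ (j + 1) := by rw [hDc, one_mul]

theorem kruglovBounded_gaugeNorm_tailBall (hN : IsRINorm N) (hK : KruglovBounded N) {n : ℕ → ℕ}
    (h0 : n 0 = 0)
    (hn : ∀ j, N (tail (n (j + 1)) ((n j : ℝ) • kruglov 1)) ≤ 2⁻¹ ^ (j + 1)) :
    KruglovBounded (gaugeNorm (tailBall N n)) := by
  obtain ⟨C, hC⟩ := hK
  refine ⟨2 * C + 1, fun x => ?_⟩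
  have hD0 : (2 * C + 1 : ℝ≥0) ≠ 0 := by positivity
  generalize hD : (2 * C + 1 : ℝ≥0) = D at hD0
  have hDpos : (0 : ℝ) < D := by positivity
  conv_rhs => rw [gaugeNorm]
  simp_rw [ENNReal.mul_iInf_of_ne (ENNReal.coe_ne_zero.2 hD0) ENNReal.coe_ne_top]
  refine le_iInf fun c => le_iInf fun hc => le_iInf fun h => ?_
  have h1 := hN.smul_kruglov_mem_tailBall hC h0 hn h
  rw [hD, kruglov_smul, smul_smul, ← mul_inv] at h1
  refine (gaugeNorm_le (mul_pos hDpos hc) h1).trans (le_of_eq ?_)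
  rw [ENNReal.ofReal_mul hDpos.le, ENNReal.ofReal_coe_nnreal]

/-- Multiples of indicator functions of `N`-norm `1` can be arbitrarily high, so that cutting them
at a fixed level hardly changes their norm. Hence their gauges are unbounded, and by the gliding
hump argument the gauge is infinite somewhere. -/
theorem exists_gaugeNorm_tailBall_eq_top (hN : IsRINorm N) (hc : SupportContinuous N) {n : ℕ → ℕ}
    (h0 : n 0 = 0) (hn : ∀ j, j ≤ n j) :
    ∃ x, N x < ∞ ∧ gaugeNorm (tailBall N n) x = ∞ := by
  have hB := hN.isUnitBall_tailBall h0 hn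
  have hG := hB.isRINorm_gaugeNorm hN.smul hN.eq_zero hN.complete
  by_contra! hcon
  obtain ⟨C, hC⟩ := hN.exists_forall_le_mul_of_forall_lt_top hG.ideal hG.smul
    fun x hx => (hcon x hx).lt_top
  -- `D` strictly exceeds the bound `C` for the gauge of functions of norm `1`.
  set D : ℝ≥0 := C + 1
  have hD0 : (0 : ℝ) < D := by positivity
  obtain ⟨j, hj⟩ : ∃ j : ℕ, D * (2⁻¹ : ℝ≥0∞) ^ j < 1 / 2 := by
    have h1 : Tendsto (fun j : ℕ => (D : ℝ≥0∞) * 2⁻¹ ^ j) atTop (𝓝 (D * 0)) :=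
      ENNReal.Tendsto.const_mul (ENNReal.tendsto_pow_atTop_nhds_zero_of_lt_one (by simp))
        (Or.inr ENNReal.coe_ne_top)
    rw [mul_zero] at h1
    exact (h1.eventually_lt_const (by simp)).exists
  -- `D * n j * χ`, the part of `y` below the level `D * n j`, has norm less than `1 / 2`.
  obtain ⟨ρ, hρ, hρD⟩ := ENNReal.exists_nnreal_pos_mul_lt
    (a := (D * n j : ℝ≥0)) (b := 1 / 2) ENNReal.coe_ne_top (by simp)
  obtain ⟨A, hA, hA0, hAρ⟩ := hc.exists_indicatorFn_lt
    (show (0 : ℝ≥0∞) < ρ by exact_mod_cast hρ)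
  set χ := indicatorFn hA
  have hχ0 : N χ ≠ 0 := by
    intro h
    have h1 := hN.eq_zero _ h
    have h2 : ∀ᵐ t : I, t ∉ A := by
      filter_upwards [coeFn_indicatorFn hA, AEEqFun.coeFn_zero (α := I) (β := ℝ)]
        with t h2 h3 ht
      rw [Set.indicator_of_mem ht] at h2
      change χ t = 1 at h2
      rw [h1, h3] at h2
      exact zero_ne_one h2
    exact hA0.ne' (by simpa [ae_iff] using h2)
  obtain ⟨r, hr⟩ : ∃ r : ℝ≥0, (r : ℝ≥0∞) = N χ := ⟨_, ENNReal.coe_toNNReal hAρ.ne_top⟩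
  have hr0 : r ≠ 0 := by
    rintro rfl
    exact hχ0 (by simpa using hr.symm)
  have hr1 : (r : ℝ) ≠ 0 := by exact_mod_cast hr0
  set y : Fn := (r : ℝ)⁻¹ • χ
  have hy : N y = 1 := by
    rw [hN.smul, enorm_inv hr1, Real.enorm_of_nonneg r.coe_nonneg, ENNReal.ofReal_coe_nnreal, hr]
    exact ENNReal.inv_mul_cancel hχ0 hAρ.ne_top
  have hyB : (D : ℝ)⁻¹ • y ∈ tailBall N n := by
    refine hB.smul_mem_of_gaugeNorm_lt hD0 ((hC y).trans_lt ?_)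
    rw [hy, mul_one, ENNReal.ofReal_coe_nnreal, ENNReal.coe_lt_coe]
    exact lt_add_one C
  have h1 : N y ≤ N ((D : ℝ) • tail (n j) ((D : ℝ)⁻¹ • y)) + N ((D * n j : ℝ) • χ) := by
    refine hN.le_add_of_abs_le ?_
    filter_upwards [coeFn_indicatorFn hA, abs_tail (n j) ((D : ℝ)⁻¹ • y),
      AEEqFun.coeFn_smul (D : ℝ)⁻¹ y, AEEqFun.coeFn_smul (r : ℝ)⁻¹ χ,
      AEEqFun.coeFn_smul (D : ℝ) (tail (n j) ((D : ℝ)⁻¹ • y)),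
      AEEqFun.coeFn_smul (D * n j : ℝ) χ] with t h1 h2 h3 h4 h5 h6
    rw [h5, h6]
    simp only [Pi.smul_apply, smul_eq_mul, abs_mul]
    rw [h2, h3, Pi.smul_apply, smul_eq_mul, abs_mul, NNReal.abs_eq, Nat.abs_cast,
      abs_of_pos (inv_pos.2 hD0)]
    change |y t| ≤ _ + _ * |indicatorFn hA t|
    rw [h1]
    by_cases htA : t ∈ A
    · rw [Set.indicator_of_mem htA, abs_one, mul_one, ← mul_add]
      calc |y t| = D * ((D : ℝ)⁻¹ * |y t|) := by field_simp
        _ ≤ _ := by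
          gcongr
          linarith [le_max_left ((D : ℝ)⁻¹ * |y t| - n j) 0]
    · have h7 : y t = 0 := by
        rw [h4, Pi.smul_apply]
        change (r : ℝ)⁻¹ • indicatorFn hA t = 0
        rw [h1, Set.indicator_of_notMem htA, smul_zero]
      rw [h7, abs_zero]
      positivity
  have h2 : N y < 1 / 2 + 1 / 2 := by
    refine h1.trans_lt (ENNReal.add_lt_add ?_ ?_)
    · rw [hN.smul, Real.enorm_of_nonneg D.coe_nonneg, ENNReal.ofReal_coe_nnreal]
      exact lt_of_le_of_lt (by gcongr; exact hyB j) hj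
    · rw [hN.smul, Real.enorm_of_nonneg (by positivity), mul_comm]
      refine lt_of_le_of_lt ?_ hρD
      have h3 : ENNReal.ofReal (D * n j) = (D * n j : ℝ≥0) := by
        rw [← ENNReal.ofReal_coe_nnreal]
        simp
      rw [h3]
      gcongr
  rw [hy, ENNReal.add_halves] at h2
  exact lt_irrefl _ h2

/-- The Kruglov operator preserves the closure of `L_∞`. -/
theorem tailsVanish_kruglov (hN : IsRINorm N) (hK : KruglovBounded N) {x : Fn}
    (hx : TailsVanish N x) : TailsVanish N (kruglov x) := by
  have h1 := hN.tailsVanish_kruglov_one hK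
  obtain ⟨C, hC⟩ := hK
  refine hN.tailsVanish_of_approx fun ε hε => ?_
  obtain ⟨ρ, hρ, hρε⟩ := ENNReal.exists_nnreal_pos_mul_lt (a := C) ENNReal.coe_ne_top hε.ne'
  obtain ⟨m, hm⟩ := hx ρ (by exact_mod_cast hρ)
  refine ⟨kruglov (clamp m x), hN.tailsVanish_mono (y := (m : ℝ) • kruglov 1) ?_
    (hN.tailsVanish_smul _ h1), ?_⟩
  · have h2 : ∀ᵐ t : I, |clamp m x t| ≤ ((m : ℝ) • (1 : Fn)) t := by
      filter_upwards [abs_clamp_le m.cast_nonneg x, AEEqFun.coeFn_smul (m : ℝ) (1 : Fn)]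
        with t h2 h3
      rw [h3]
      simpa using h2
    filter_upwards [abs_kruglov_le h2] with s hs
    rw [← kruglov_smul]
    exact hs.trans (le_abs_self _)
  · have h3 : kruglov x - kruglov (clamp m x) = kruglov (x - clamp m x) := by
      rw [sub_eq_add_neg, sub_eq_add_neg, kruglov_add, ← neg_one_smul ℝ (clamp m x),
        kruglov_smul, neg_one_smul]
    rw [h3]
    calc N (kruglov (x - clamp m x)) ≤ C * N (x - clamp m x) := hC _
      _ ≤ C * ρ := by
        gcongr
        refine (hN.ideal _ _ ?_).trans hm.le
        filter_upwards [abs_sub_clamp m.cast_nonneg x] with t ht using ht.le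
      _ = ρ * C := mul_comm _ _
      _ < ε := hρε

end IsRINorm

theorem hasKruglov_separablePart {N : Fn → ℝ≥0∞} (hN : IsRINorm N) (hK : KruglovBounded N) :
    (separablePart N hN (hN.supportContinuous hK)).HasKruglov := by
  refine (hasKruglov_iff _).2 fun f hf => ?_
  exact hN.separablePartNorm_lt_top_iff.2
    (hN.tailsVanish_kruglov hK (hN.separablePartNorm_lt_top_iff.1 hf))

theorem exists_hasKruglov_carrier_ssubset (E : RISpace) (hE : E.HasKruglov) :
    ∃ F : RISpace, F.HasKruglov ∧ F.carrier ⊂ E.carrier := by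
  have hN := E.isRINorm
  have hK := kruglovBounded_of_forall_lt_top hN ((hasKruglov_iff E).1 hE)
  have hc := hN.supportContinuous hK
  obtain ⟨n, h0, hn, hgrowth⟩ := hN.exists_levels (hN.tailsVanish_kruglov_one hK)
  have hB := hN.isUnitBall_tailBall h0 hn
  have hG := hB.isRINorm_gaugeNorm hN.smul hN.eq_zero hN.complete
  have hGK := hN.kruglovBounded_gaugeNorm_tailBall hK h0 hgrowth
  refine ⟨separablePart _ hG (hG.supportContinuous hGK), hasKruglov_separablePart hG hGK, ?_⟩
  refine Set.ssubset_iff_subset_ne.2 ⟨fun x hx => ?_, fun heq => ?_⟩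
  · exact ((hB.le_gaugeNorm hN.smul x).trans (hG.le_separablePartNorm x)).trans_lt hx
  · obtain ⟨x, hx, hx'⟩ := hN.exists_gaugeNorm_tailBall_eq_top hc h0 hn
    have h1 : x ∈ E.carrier := hx
    rw [← heq] at h1
    exact ((hG.le_separablePartNorm x).trans_lt h1).ne hx'

/-! ### The space `exp L₁` -/

/-- The norm of `L₁`. -/
def oneNorm (x : Fn) : ℝ≥0∞ := eLpNorm x 1 (volume : Measure I)

theorem oneNorm_smul (c : ℝ) (x : Fn) : oneNorm (c • x) = ‖c‖ₑ * oneNorm x := by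
  rw [oneNorm, eLpNorm_congr_ae (AEEqFun.coeFn_smul c x), eLpNorm_const_smul, oneNorm]

theorem eq_zero_of_oneNorm (x : Fn) (h : oneNorm x = 0) : x = 0 := by
  rw [oneNorm, eLpNorm_eq_zero_iff x.aestronglyMeasurable one_ne_zero] at h
  exact AEEqFun.ext (h.trans (AEEqFun.coeFn_zero).symm)

theorem isCompleteNorm_oneNorm : IsCompleteNorm oneNorm := by
  intro u hu hcauchy
  let v : ℕ → Lp ℝ 1 (volume : Measure I) := fun n => ⟨u n, Lp.mem_Lp_iff_eLpNorm_lt_top.2 (hu n)⟩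
  have hedist : ∀ m, ∀ y : Lp ℝ 1 (volume : Measure I), edist (v m) y = oneNorm (u m - y) := by
    intro m y
    rw [Lp.edist_def, oneNorm]
    exact eLpNorm_congr_ae (AEEqFun.coeFn_sub (u m) y.1).symm
  have hv : CauchySeq v := by
    refine EMetric.cauchySeq_iff.2 fun ε hε => ?_
    obtain ⟨n₀, h⟩ := hcauchy ε hε
    refine ⟨n₀, fun m hm n hn => ?_⟩
    rw [hedist]
    exact h m hm n hn
  obtain ⟨x, hx⟩ := cauchySeq_tendsto_of_complete hv
  refine ⟨x.1, Lp.mem_Lp_iff_eLpNorm_lt_top.1 x.2, ?_⟩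
  have h := tendsto_iff_edist_tendsto_0.1 hx
  simp_rw [hedist] at h
  exact h

/-- The unit ball of `exp L₁`. -/
def expBall : Set Fn := {x | ∫⁻ t : I, ENNReal.ofReal (Real.exp |x t| - 1) ≤ 1}

theorem expL1Norm_eq_gaugeNorm : expL1Norm = gaugeNorm expBall := by
  funext x
  unfold expL1Norm orliczNorm gaugeNorm
  refine iInf_congr fun c => iInf_congr fun hc => ?_
  have h : ∫⁻ t : I, ENNReal.ofReal (Real.exp (|x t| / c) - 1) =
      ∫⁻ t : I, ENNReal.ofReal (Real.exp |(c⁻¹ • x : Fn) t| - 1) := by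
    refine lintegral_congr_ae ?_
    filter_upwards [AEEqFun.coeFn_smul c⁻¹ x] with t ht
    rw [ht, Pi.smul_apply, smul_eq_mul, abs_mul, abs_of_pos (inv_pos.2 hc), div_eq_inv_mul]
  rw [h]
  rfl

theorem isUnitBall_expBall : IsUnitBall oneNorm expBall where
  convex x hx y hy a b ha hb hab := by
    calc ∫⁻ t : I, ENNReal.ofReal (Real.exp |(a • x + b • y : Fn) t| - 1)
        ≤ ∫⁻ t : I, (ENNReal.ofReal a * ENNReal.ofReal (Real.exp |x t| - 1) +
            ENNReal.ofReal b * ENNReal.ofReal (Real.exp |y t| - 1)) := by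
          refine lintegral_mono_ae ?_
          filter_upwards [AEEqFun.coeFn_add (a • x) (b • y), AEEqFun.coeFn_smul a x,
            AEEqFun.coeFn_smul b y] with t h1 h2 h3
          rw [h1, Pi.add_apply, h2, h3]
          simp only [Pi.smul_apply, smul_eq_mul]
          have hx1 : 0 ≤ Real.exp |x t| - 1 := by simp
          have hy1 : 0 ≤ Real.exp |y t| - 1 := by simp
          rw [← ENNReal.ofReal_mul ha, ← ENNReal.ofReal_mul hb,
            ← ENNReal.ofReal_add (by positivity) (by positivity)]
          refine ENNReal.ofReal_le_ofReal ?_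
          have h4 : |a * x t + b * y t| ≤ a * |x t| + b * |y t| := by
            refine (abs_add_le _ _).trans_eq ?_
            rw [abs_mul, abs_mul, abs_of_nonneg ha, abs_of_nonneg hb]
          have h5 := convexOn_exp.2 (Set.mem_univ |x t|) (Set.mem_univ |y t|) ha hb hab
          simp only [smul_eq_mul] at h5
          have h6 := (Real.exp_le_exp.2 h4).trans h5
          linarith
      _ = ENNReal.ofReal a * (∫⁻ t : I, ENNReal.ofReal (Real.exp |x t| - 1)) +
            ENNReal.ofReal b * ∫⁻ t : I, ENNReal.ofReal (Real.exp |y t| - 1) := by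
          have hxm := x.measurable
          have hym := y.measurable
          rw [lintegral_add_left (by fun_prop), lintegral_const_mul _ (by fun_prop),
            lintegral_const_mul _ (by fun_prop)]
      _ ≤ ENNReal.ofReal a * 1 + ENNReal.ofReal b * 1 := by
          gcongr
          · exact hx
          · exact hy
      _ = 1 := by
          rw [mul_one, mul_one, ← ENNReal.ofReal_add ha hb, hab, ENNReal.ofReal_one]
  solid x y h hy := by
    refine le_trans (lintegral_mono_ae ?_) hy
    filter_upwards [h] with t ht
    gcongr
  symmetric x y h hy := by
    have hm : Measurable fun r : ℝ => ENNReal.ofReal (Real.exp r - 1) := by fun_prop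
    refine le_of_eq_of_le (b := ∫⁻ t : I, ENNReal.ofReal (Real.exp |y t| - 1)) ?_ hy
    exact (h.identDistrib.comp hm).lintegral_eq
  absorbs_one := by
    have hlog : 0 < Real.log 2 := Real.log_pos one_lt_two
    refine ⟨Real.log 2, hlog, ?_⟩
    have h : ∀ᵐ t : I, ENNReal.ofReal (Real.exp |(Real.log 2 • (1 : Fn)) t| - 1) = 1 := by
      filter_upwards [AEEqFun.coeFn_smul (Real.log 2) (1 : Fn)] with t ht
      rw [ht]
      simp only [Pi.smul_apply, AEEqFun.coeFn_one_eq, smul_eq_mul, mul_one]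
      rw [abs_of_pos hlog, Real.exp_log two_pos]
      norm_num
    change ∫⁻ t : I, ENNReal.ofReal (Real.exp |(Real.log 2 • (1 : Fn)) t| - 1) ≤ 1
    rw [lintegral_congr_ae h]
    simp
  le_one x hx := by
    rw [oneNorm, eLpNorm_one_eq_lintegral_enorm]
    refine le_trans (lintegral_mono fun t => ?_) hx
    rw [← ofReal_norm, Real.norm_eq_abs]
    refine ENNReal.ofReal_le_ofReal ?_
    linarith [Real.add_one_le_exp |x t|]
  -- Convergence in `L₁` yields a subsequence that converges almost everywhere, and Fatou's lemma
  -- applies to it.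
  closed v x hv hlim := by
    have h1 : Tendsto (fun m => eLpNorm (v m - x : I → ℝ) 1 (volume : Measure I)) atTop (𝓝 0) :=
      hlim.congr fun m => eLpNorm_congr_ae (AEEqFun.coeFn_sub (v m) x)
    obtain ⟨ns, -, hns⟩ := (tendstoInMeasure_of_tendsto_eLpNorm one_ne_zero
      (fun m => (v m).aestronglyMeasurable) x.aestronglyMeasurable h1).exists_seq_tendsto_ae
    calc ∫⁻ t : I, ENNReal.ofReal (Real.exp |x t| - 1)
        = ∫⁻ t : I, liminf (fun i => ENNReal.ofReal (Real.exp |v (ns i) t| - 1)) atTop := by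
          refine lintegral_congr_ae ?_
          filter_upwards [hns] with t ht
          refine (Tendsto.liminf_eq ?_).symm
          have hc : Continuous fun r : ℝ => ENNReal.ofReal (Real.exp |r| - 1) :=
            ENNReal.continuous_ofReal.comp (by fun_prop)
          exact (hc.tendsto _).comp ht
      _ ≤ liminf (fun i => ∫⁻ t : I, ENNReal.ofReal (Real.exp |v (ns i) t| - 1)) atTop := by
          refine lintegral_liminf_le fun i => ?_
          have := (v (ns i)).measurable
          fun_prop
      _ ≤ 1 := by
          refine (liminf_le_liminf (Eventually.of_forall fun i => hv (ns i))).trans ?_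
          simp

theorem isRINorm_expL1Norm : IsRINorm expL1Norm := by
  rw [expL1Norm_eq_gaugeNorm]
  exact isUnitBall_expBall.isRINorm_gaugeNorm oneNorm_smul eq_zero_of_oneNorm
    isCompleteNorm_oneNorm

/-- The space `exp L₁` consists of the functions that have some finite exponential moment. -/
theorem expL1Norm_lt_top_iff (x : Fn) : expL1Norm x < ∞ ↔
    ∃ s : ℝ, 0 < s ∧ ∫⁻ t : I, ENNReal.ofReal (Real.exp (s * |x t|)) < ∞ := by
  have hx := x.measurable
  constructor
  · intro h
    rw [expL1Norm_eq_gaugeNorm] at h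
    obtain ⟨c, hc, h, -⟩ := exists_smul_mem_of_gaugeNorm_lt h
    refine ⟨c⁻¹, inv_pos.2 hc, ?_⟩
    calc ∫⁻ t : I, ENNReal.ofReal (Real.exp (c⁻¹ * |x t|))
        ≤ ∫⁻ t : I, (ENNReal.ofReal (Real.exp |(c⁻¹ • x : Fn) t| - 1) + 1) := by
          refine lintegral_mono_ae ?_
          filter_upwards [AEEqFun.coeFn_smul c⁻¹ x] with t ht
          rw [ht, Pi.smul_apply, smul_eq_mul, abs_mul, abs_of_pos (inv_pos.2 hc),
            ← ENNReal.ofReal_one, ← ENNReal.ofReal_add (by simp; positivity) zero_le_one,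
            sub_add_cancel]
      _ = (∫⁻ t : I, ENNReal.ofReal (Real.exp |(c⁻¹ • x : Fn) t| - 1)) + 1 := by
          rw [lintegral_add_right _ measurable_const]
          simp
      _ ≤ 1 + 1 := by gcongr; exact h
      _ < ∞ := by finiteness
  · rintro ⟨s, hs, h⟩
    obtain ⟨k, hk⟩ := ENNReal.exists_nat_gt h.ne
    have hk0 : (0 : ℝ) < k := by
      rcases Nat.eq_zero_or_pos k with rfl | hk0
      · simp at hk
      · exact_mod_cast hk0
    rw [expL1Norm_eq_gaugeNorm]
    refine (gaugeNorm_le (c := k / s) (by positivity) ?_).trans_lt ENNReal.ofReal_lt_top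
    -- By Bernoulli's inequality, `exp (u / k) - 1 ≤ exp u / k`.
    calc ∫⁻ t : I, ENNReal.ofReal (Real.exp |((k / s : ℝ)⁻¹ • x : Fn) t| - 1)
        ≤ ∫⁻ t : I, ENNReal.ofReal (k : ℝ)⁻¹ * ENNReal.ofReal (Real.exp (s * |x t|)) := by
          refine lintegral_mono_ae ?_
          filter_upwards [AEEqFun.coeFn_smul (k / s : ℝ)⁻¹ x] with t ht
          rw [ht, Pi.smul_apply, smul_eq_mul, abs_mul, abs_of_pos (by positivity),
            ← ENNReal.ofReal_mul (by positivity)]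
          refine ENNReal.ofReal_le_ofReal ?_
          rw [le_inv_mul_iff₀ hk0]
          have h1 := one_add_mul_le_pow (a := Real.exp ((k / s : ℝ)⁻¹ * |x t|) - 1)
            (by linarith [Real.exp_pos ((k / s : ℝ)⁻¹ * |x t|)]) k
          have h2 : Real.exp ((k / s : ℝ)⁻¹ * |x t|) ^ k = Real.exp (s * |x t|) := by
            rw [← Real.exp_nat_mul]
            congr 1
            field_simp
          rw [add_sub_cancel, h2] at h1
          linarith
      _ = ENNReal.ofReal (k : ℝ)⁻¹ * ∫⁻ t : I, ENNReal.ofReal (Real.exp (s * |x t|)) :=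
          lintegral_const_mul _ (by fun_prop)
      _ ≤ ENNReal.ofReal (k : ℝ)⁻¹ * k := by gcongr
      _ = 1 := by
          rw [← ENNReal.ofReal_natCast, ← ENNReal.ofReal_mul (by positivity),
            inv_mul_cancel₀ hk0.ne', ENNReal.ofReal_one]

/-- If `m` is the integral of `g`, the product has integral `∑ n, e⁻¹ mⁿ / n! = exp (m - 1)`. -/
theorem lintegral_prod_poissonProb {g : I → ℝ≥0∞} (hg : Measurable g) (hfin : ∫⁻ t, g t < ∞) :
    ∫⁻ p, ∏ i ∈ Finset.range p.1, g (p.2 i) ∂poissonProb < ∞ := by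
  have hmeas : Measurable fun p : ℕ × (ℕ → I) => ∏ i ∈ Finset.range p.1, g (p.2 i) := by
    refine measurable_from_prod_countable_right fun n => ?_
    change Measurable fun ω : ℕ → I => ∏ i ∈ Finset.range n, g (ω i)
    exact Finset.measurable_fun_prod _ fun i _ => hg.comp (measurable_pi_apply i)
  have hprod : ∀ n : ℕ, ∫⁻ ω : ℕ → I, ∏ i ∈ Finset.range n, g (ω i)
      ∂(Measure.infinitePi fun _ : ℕ => (volume : Measure I)) = (∫⁻ t, g t) ^ n := by
    intro n
    rw [lintegral_prod_eq_prod_lintegral_of_indepFun (Finset.range n)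
      (fun i (ω : ℕ → I) => g (ω i)) (iIndepFun_infinitePi (X := fun _ => g) fun _ => hg)
      fun i => hg.comp (measurable_pi_apply i)]
    have h1 : ∀ i : ℕ, ∫⁻ ω : ℕ → I, g (ω i)
        ∂(Measure.infinitePi fun _ : ℕ => (volume : Measure I)) = ∫⁻ t, g t := fun i =>
      (measurePreserving_eval_infinitePi (fun _ : ℕ => (volume : Measure I)) i).lintegral_comp hg
    simp [h1]
  rw [poissonProb, lintegral_prod _ hmeas.aemeasurable]
  simp_rw [hprod]
  rw [poissonMeasure, lintegral_sum_measure]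
  simp_rw [lintegral_smul_measure, lintegral_dirac]
  obtain ⟨m, hm⟩ : ∃ m : ℝ≥0, (m : ℝ≥0∞) = ∫⁻ t, g t := ⟨_, ENNReal.coe_toNNReal hfin.ne⟩
  rw [← hm]
  have h2 : ∀ n : ℕ, ENNReal.ofReal (Real.exp (-(1 : ℝ≥0)) * (1 : ℝ≥0) ^ n / n.factorial) •
      (m : ℝ≥0∞) ^ n = ENNReal.ofReal (Real.exp (-1) * ((m : ℝ) ^ n / n.factorial)) := by
    intro n
    rw [← ENNReal.ofReal_coe_nnreal, ← ENNReal.ofReal_pow m.coe_nonneg, smul_eq_mul,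
      ← ENNReal.ofReal_mul (by positivity)]
    congr 1
    simp only [NNReal.coe_one, one_pow]
    ring
  simp_rw [h2]
  rw [← ENNReal.ofReal_tsum_of_nonneg (fun n => by positivity)
    ((Real.summable_pow_div_factorial m).mul_left _)]
  exact ENNReal.ofReal_lt_top

theorem expL1Norm_kruglov_lt_top {f : Fn} (hf : expL1Norm f < ∞) :
    expL1Norm (kruglov f) < ∞ := by
  rw [expL1Norm_lt_top_iff] at hf ⊢
  obtain ⟨s, hs, h⟩ := hf
  refine ⟨s, hs, ?_⟩
  have hfm := f.measurable
  have hg : Measurable fun t : I => ENNReal.ofReal (Real.exp (s * |f t|)) := by fun_prop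
  have hpm : Measurable fun p => ENNReal.ofReal (Real.exp (s * |poissonSum f p|)) := by
    have := measurable_poissonSum f
    fun_prop
  calc ∫⁻ t : I, ENNReal.ofReal (Real.exp (s * |kruglov f t|))
      = ∫⁻ t : I, ENNReal.ofReal (Real.exp (s * |poissonSum f (poissonMap t)|)) := by
        refine lintegral_congr_ae ?_
        filter_upwards [coeFn_kruglov f] with t ht
        rw [ht]
    _ = ∫⁻ p, ENNReal.ofReal (Real.exp (s * |poissonSum f p|)) ∂poissonProb :=
        measurePreserving_poissonMap.lintegral_comp hpm
    _ ≤ ∫⁻ p, ∏ i ∈ Finset.range p.1, ENNReal.ofReal (Real.exp (s * |f (p.2 i)|))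
          ∂poissonProb := by
        refine lintegral_mono fun p => ?_
        dsimp only
        rw [← ENNReal.ofReal_prod_of_nonneg fun _ _ => (Real.exp_pos _).le, ← Real.exp_sum,
          ← Finset.mul_sum]
        gcongr
        exact Finset.abs_sum_le_sum_abs _ _
    _ < ∞ := lintegral_prod_poissonProb hg h

theorem kruglovBounded_expL1Norm : KruglovBounded expL1Norm :=
  kruglovBounded_of_forall_lt_top isRINorm_expL1Norm fun _ => expL1Norm_kruglov_lt_top

end RI

end

theorem mainTheorem3 :
    (∀ E : RISpace, E.HasKruglov → ∃ F : RISpace, F.HasKruglov ∧ F.carrier ⊂ E.carrier) ∧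
    (¬ ∃ S : Set RI.Fn, Minimal RI.IsKruglovSet S) ∧
    (∃ G : RISpace, G.enorm = RI.separablePartNorm RI.expL1Norm ∧ G.HasKruglov ∧
      ∃ F : RISpace, F.HasKruglov ∧ F.carrier ⊂ G.carrier) := by
  refine ⟨RI.exists_hasKruglov_carrier_ssubset, ?_, ?_⟩
  · rintro ⟨S, ⟨E, hE, rfl⟩, hmin⟩
    obtain ⟨F, hF, hFE⟩ := RI.exists_hasKruglov_carrier_ssubset E hE
    exact hFE.2 (hmin ⟨F, hF, rfl⟩ hFE.1)
  · have hG := RI.hasKruglov_separablePart RI.isRINorm_expL1Norm RI.kruglovBounded_expL1Norm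
    exact ⟨_, rfl, hG, RI.exists_hasKruglov_carrier_ssubset _ hG⟩
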